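/- All algebras are unital $\star$-algebras over $\mathbb C$ and all inclusions are unital. Let $(\mathcal D\subseteq\mathcal A,E)$ be a $\mathcal D$-valued probability space: $\mathcal A$ is a unital $\star$-algebra, $\mathcal D\subseteq\mathcal A$ a unital $\star$-subalgebra, and $E:\mathcal A\to\mathcal D$ a conditional expectation, i.e. a linear map with $E(I)=I$, $E(d_1xd_2)=d_1E(x)d_2$ and $E(x^\star)=E(x)^\star$ for all $x\in\mathcal A$, $d_1,d_2\in\mathcal D$. Let $a\in\mathcal A$. *Notions used.* An *enlargement* of $(\mathcal D\subseteq\mathcal A,E)$ is a $\mathcal D$-valued probability space $(\mathcal D\subseteq\tilde{\mathcal A},\tilde E)$ with $\mathcal A\subseteq\tilde{\mathcal A}$ a unital $\star$-subalgebra and $\tilde E|_{\mathcal A}=E$. Sets $(X_s)_{s\in S}$ are *free over $\mathcal D$* if for the algebras $\mathcal A_s=\mathrm{Alg}(X_s\cup\mathcal D)$ one has $E(x_1\cdots x_n)=0$ whenever $n\ge1$, $s_1\ne s_2\ne\cdots\ne s_n$, $x_k\in\mathcal A_{s_k}$ and $E(x_1)=\cdots=E(x_n)=0$. Elements $x,y$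 are *identically $\mathcal D$-distributed* if $E(x^{s_1}d_1x^{s_2}\cdots d_{n-1}x^{s_n})=E(y^{s_1}d_1y^{s_2}\cdots d_{n-1}y^{s_n})$ for all $n\ge1$, $s_k\in\{1,\star\}$, $d_k\in\mathcal D$. An element $y$ is *scalar* if $yy^\star=y^\star y$, $y$ and $y^\star$ commute with every element of $\mathcal D$, and $E(y^k(y^\star)^l)\in\mathbb CI$ for all $k,l\ge0$. The *$\mathcal D$-valued noncrossing cumulants* $\kappa(a_1\otimes\cdots\otimes a_n)\in\mathcal D$, $n\ge1$, are the unique solution of $$E(a_1a_2\cdots a_n)=\langle\Omega,\rho(a_1)\rho(a_2)\cdots\rho(a_n)\Omega\rangle\qquad(n\ge1,\ a_1,\dots,a_n\in\mathcal A),$$ where on the free Fock space $\Gamma=\bigoplus_{n\ge0}\mathcal A^{\otimes_{\mathcal D}n}$, with $\mathcal A^{\otimes_{\mathcal D}0}=\mathcal D$ and $\Omega=I\in\mathcal D$, one puts $\rho(a)d=ad+\kappa(a)d$ for $d\in\mathcal D$ and $$\rho(a)[b_1\otimes\cdots\otimes b_n]=a\otimes b_1\otimes\cdots\otimes b_n+\sum_{i=0}^{n-1}[\kappa(a\otimes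 b_1\otimes\cdots\otimes b_i)b_{i+1}]\otimes b_{i+2}\otimes\cdots\otimes b_n+\kappa(a\otimes b_1\otimes\cdots\otimes b_n),$$ and $\langle\Omega,v\rangle$ is the component of $v\in\Gamma$ in $\mathcal D$. **Theorem and Definition.** The following conditions on $a$ are equivalent; $a$ is called *$R$-diagonal with amalgamation over $\mathcal D$* if it satisfies one (hence all) of them. 1. Let $$P_{11}=\mathrm{span}\{\mathcal Da^\star\mathcal D,\ \mathcal Da^\star\mathcal Da\mathcal Da^\star\mathcal D,\dots\},\qquad P_{12}=\{x\in\mathrm{span}\{\mathcal D,\ \mathcal Da^\star\mathcal Da\mathcal D,\ \mathcal Da^\star\mathcal Da\mathcal Da^\star\mathcal Da\mathcal D,\dots\}:E(x)=0\},$$ $$P_{21}=\{x\in\mathrm{span}\{\mathcal D,\ \mathcal Da\mathcal Da^\star\mathcal D,\ \mathcal Da\mathcal Da^\star\mathcal Da\mathcal Da^\star\mathcal D,\dots\}:E(x)=0\},\qquad P_{22}=\mathrm{span}\{\mathcal Da\mathcal D,\ \mathcal Da\mathcal Da^\star\mathcal Da\mathcal D,\dots\}.$$ Then $E(x_1x_2\cdots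 x_n)=0$ for every $n\ge1$, all $i_1,\dots,i_{n+1}\in\{1,2\}$ and all $x_1\in P_{i_1i_2},\ x_2\in P_{i_2i_3},\dots,x_n\in P_{i_ni_{n+1}}$. 2. $\kappa(d_1a^{s_1}\otimes d_2a^{s_2}\otimes\cdots\otimes d_na^{s_n})=0$ for all $n\ge1$, $d_1,\dots,d_n\in\mathcal D$ and $s_1,\dots,s_n\in\{1,\star\}$ such that $(s_1,\dots,s_n)$ is neither of the form $(1,\star,1,\star,\dots,1,\star)$ nor of the form $(\star,1,\star,1,\dots,\star,1)$. 3. There exist an enlargement $(\mathcal D\subseteq\tilde{\mathcal A},\tilde E)$ of $(\mathcal D\subseteq\mathcal A,E)$ and a scalar unitary $u\in\tilde{\mathcal A}$ such that $\{a,a^\star\}$ and $\{u,u^\star\}$ are free over $\mathcal D$, $|\tilde E(u)|<1$ (where $\tilde E(u)\in\mathbb CI$ is regarded as a complex number), and $a$ and $ua$ are identically $\mathcal D$-distributed. 4. For every enlargement $(\mathcal D\subseteq\tilde{\mathcal A},\tilde E)$ of $(\mathcal D\subseteq\mathcal A,E)$ and every scalar unitary $u\in\tilde{\mathcal A}$ such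 that $\{a,a^\star\}$ and $\{u,u^\star\}$ are free over $\mathcal D$, the elements $a$ and $ua$ are identically $\mathcal D$-distributed. -/

import Mathlib

universe u

noncomputable section

namespace OpValued

variable {A : Type u} [Ring A] [StarRing A] [Algebra ℂ A] [StarModule ℂ A]

/-- A conditional expectation of the unital `*`-algebra `A` onto the unital `*`-subalgebra `D`:
a linear, unital, `D`-bimodule map that commutes with the involution.  The triple `(D ⊆ A, E)` is
a `D`-valued probability space. -/
structure CondExp (D : StarSubalgebra ℂ A) extends A →ₗ[ℂ] D where
  map_one' : toFun 1 = 1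
  map_bimod' : ∀ (d₁ d₂ : D) (x : A), toFun ((d₁ : A) * x * (d₂ : A)) = d₁ * toFun x * d₂
  map_star' : ∀ x : A, toFun (star x) = star (toFun x)

instance (D : StarSubalgebra ℂ A) : CoeFun (CondExp D) (fun _ => A → D) :=
  ⟨fun E => E.toLinearMap⟩

/-- The exponents `1` and `⋆`. -/
inductive Letter where
  | one
  | star

/-- `x ^ s` for an exponent `s ∈ {1, ⋆}`. -/
def letterPow (x : A) : Letter → A
  | Letter.one => x
  | Letter.star => star x

section Basic

variable {D : StarSubalgebra ℂ A} (E : CondExp D)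

/-- `x` and `y` are identically `D`-distributed:
`E (x^{s₀} d₁ x^{s₁} ⋯ dₘ x^{sₘ}) = E (y^{s₀} d₁ y^{s₁} ⋯ dₘ y^{sₘ})` for all `m ≥ 0`, all
exponents `sᵢ` and all `dᵢ ∈ D`; the list `w` is `[(d₁, s₁), …, (dₘ, sₘ)]`. -/
def IdentDistrib (x y : A) : Prop :=
  ∀ (s₀ : Letter) (w : List (D × Letter)),
    E (letterPow x s₀ * (w.map fun p => (p.1 : A) * letterPow x p.2).prod) =
      E (letterPow y s₀ * (w.map fun p => (p.1 : A) * letterPow y p.2).prod)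

/-- The sets `X s` are free with amalgamation over `D`, i.e. the algebras generated by
`X s ∪ D` are. -/
def FreeOver {S : Type*} (X : S → Set A) : Prop :=
  ∀ (n : ℕ), 1 ≤ n → ∀ (s : Fin n → S) (x : Fin n → A),
    (∀ i j : Fin n, (j : ℕ) = i + 1 → s i ≠ s j) →
    (∀ i, x i ∈ Algebra.adjoin ℂ (X (s i) ∪ (D : Set A))) →
    (∀ i, E (x i) = 0) →
    E (List.ofFn x).prod = 0

/-- Scalar random variables: `y` is normal, `y` and `y⋆` commute with `D`, and all the
expectations `E (y^k (y⋆)^l)` are complex multiples of the identity. -/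
def IsScalarVar (y : A) : Prop :=
  y * star y = star y * y ∧
  (∀ d : D, y * (d : A) = (d : A) * y ∧ star y * (d : A) = (d : A) * star y) ∧
  ∀ k l : ℕ, ∃ α : ℂ, E (y ^ k * (star y) ^ l) = algebraMap ℂ D α

/-! ### The free Fock space and the operator-valued cumulants

A pair `([b₁, …, bₙ], d)` stands for the vector `b₁ ⊗ ⋯ ⊗ bₙ d` of the free Fock space
`⨁ A^{⊗_D n}` (for `n = 0`, for the vector `d ∈ D`), and a list of such pairs for their sum. -/

/-- The operator `ρ(a)` built from `κ`, on a single word: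
`ρ(a)[b₁ ⊗ ⋯ ⊗ bₙ] = a ⊗ b₁ ⊗ ⋯ ⊗ bₙ
  + ∑_{0 ≤ i < n} (κ(a ⊗ b₁ ⊗ ⋯ ⊗ bᵢ) bᵢ₊₁) ⊗ bᵢ₊₂ ⊗ ⋯ ⊗ bₙ + κ(a ⊗ b₁ ⊗ ⋯ ⊗ bₙ)`,
and `ρ(a)[d] = a d + κ(a) d`. -/
def rho (κ : List A → D) (a : A) (v : List A × D) : List (List A × D) :=
  (a :: v.1, v.2) :: ([], κ (a :: v.1) * v.2) ::
    (List.finRange v.1.length).map fun i : Fin v.1.length =>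
      (((κ (a :: v.1.take i) : D) : A) * v.1.get i :: v.1.drop ((i : ℕ) + 1), v.2)

/-- The vector `ρ(a₁) ⋯ ρ(aₙ) Ω`, with `Ω = 1 ∈ D`. -/
def fockVector (κ : List A → D) : List A → List (List A × D)
  | [] => [([], 1)]
  | a :: l => (fockVector κ l).flatMap (rho κ a)

/-- The functional `⟨Ω, ·⟩`, which returns the component in `D`. -/
def vacuum (v : List (List A × D)) : D :=
  (v.map fun w => if w.1.length = 0 then w.2 else 0).sum

/-- The vacuum expectation `⟨Ω, ρ(a₁) ⋯ ρ(aₙ) Ω⟩`. -/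
def fockMoment (κ : List A → D) (l : List A) : D :=
  vacuum (fockVector κ l)

/-- The `D`-valued noncrossing cumulants `κ(a₁ ⊗ ⋯ ⊗ aₙ)`, where `l = [a₁, …, aₙ]`.  In
`E(a₁ ⋯ aₙ) = ⟨Ω, ρ(a₁) ⋯ ρ(aₙ) Ω⟩` the right-hand side is `κ(a₁ ⊗ ⋯ ⊗ aₙ)` plus terms which
only involve cumulants of fewer than `n` arguments; this is solved for `κ(a₁ ⊗ ⋯ ⊗ aₙ)`.  See
`fockMoment_cumulant` and `cumulant_unique`. -/
def cumulant (l : List A) : D :=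
  E l.prod -
    fockMoment (fun m => if _h : m.length < l.length then cumulant m else 0) l
termination_by l.length

theorem length_le_of_mem_rho {κ : List A → D} {a : A} {v w : List A × D}
    (h : w ∈ rho κ a v) : w.1.length ≤ v.1.length + 1 := by
  simp only [rho, List.mem_cons, List.mem_map] at h
  rcases h with rfl | rfl | ⟨i, -, rfl⟩
  · simp
  · simp
  · simp only [List.length_cons, List.length_drop]
    omega

theorem length_le_of_mem_fockVector {κ : List A → D} {l : List A} :
    ∀ {w : List A × D}, w ∈ fockVector κ l → w.1.length ≤ l.length := by
  induction l with
  | nil => intro w h; simp [fockVector] at h; simp [h]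
  | cons a l ih =>
    intro w h
    simp only [fockVector, List.mem_flatMap] at h
    obtain ⟨v, hv, hw⟩ := h
    have h1 := ih hv
    have h2 := length_le_of_mem_rho hw
    simp only [List.length_cons]
    omega

theorem rho_congr {κ κ' : List A → D} {a : A} {v : List A × D}
    (h : ∀ m : List A, m ≠ [] → m.length ≤ v.1.length + 1 → κ m = κ' m) :
    rho κ a v = rho κ' a v := by
  unfold rho
  rw [h (a :: v.1) (by simp) (by simp)]
  congr 2
  apply List.map_congr_left
  intro i _
  rw [h (a :: v.1.take i) (by simp) (by simp)]

theorem fockVector_congr {κ κ' : List A → D} {l : List A}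
    (h : ∀ m : List A, m ≠ [] → m.length ≤ l.length → κ m = κ' m) :
    fockVector κ l = fockVector κ' l := by
  induction l with
  | nil => rfl
  | cons a l ih =>
    have hl := ih (fun m h0 hm => h m h0 (by simp only [List.length_cons]; omega))
    simp only [fockVector, hl]
    apply List.flatMap_congr
    intro v hv
    have h1 := length_le_of_mem_fockVector hv
    exact rho_congr fun m h0 hm => h m h0 (by simp only [List.length_cons]; omega)

theorem fockVector_eq_cons (κ : List A → D) (l : List A) :
    ∃ r, fockVector κ l = (l, 1) :: r ∧ ∀ w ∈ r, w.1.length < l.length := by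
  induction l with
  | nil => exact ⟨[], rfl, by simp⟩
  | cons a l ih =>
    obtain ⟨r, hr, hlt⟩ := ih
    refine ⟨(rho κ a (l, 1)).tail ++ r.flatMap (rho κ a), ?_, ?_⟩
    · simp [fockVector, hr, rho]
    · intro w hw
      rw [List.mem_append] at hw
      rcases hw with hw | hw
      · simp only [rho, List.tail_cons, List.mem_cons, List.mem_map] at hw
        rcases hw with rfl | ⟨i, -, rfl⟩
        · simp
        · have := i.2
          simp only [List.length_cons, List.length_drop]
          omega
      · obtain ⟨v, hv, hw⟩ := List.mem_flatMap.1 hw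
        have h1 := hlt v hv
        have h2 := length_le_of_mem_rho hw
        simp only [List.length_cons]
        omega

theorem vacuum_append (v w : List (List A × D)) : vacuum (v ++ w) = vacuum v + vacuum w := by
  simp [vacuum]

theorem vacuum_rho (κ : List A → D) (a : A) (v : List A × D) :
    vacuum (rho κ a v) = κ (a :: v.1) * v.2 := by
  simp [vacuum, rho, Function.comp_def]

/-- Exactly one term of the vacuum expectation contains the top cumulant. -/
theorem fockMoment_sub {κ κ' : List A → D} {l : List A} (hl : l ≠ [])
    (h : ∀ m : List A, m ≠ [] → m.length < l.length → κ m = κ' m) :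
    fockMoment κ l - κ l = fockMoment κ' l - κ' l := by
  obtain _ | ⟨a, l⟩ := l
  · exact absurd rfl hl
  have hv : fockVector κ l = fockVector κ' l :=
    fockVector_congr fun m h0 hm => h m h0 (by simp only [List.length_cons]; omega)
  obtain ⟨r, hr, hlt⟩ := fockVector_eq_cons κ' l
  have hrest : r.flatMap (rho κ a) = r.flatMap (rho κ' a) := by
    apply List.flatMap_congr
    intro v hv
    have h1 := hlt v hv
    exact rho_congr fun m h0 hm => h m h0 (by simp only [List.length_cons]; omega)
  simp only [fockMoment, fockVector, hv, hr, List.flatMap_cons, vacuum_append, vacuum_rho, hrest]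
  simp

/-- The moment-cumulant formula `E(a₁ ⋯ aₙ) = ⟨Ω, ρ(a₁) ⋯ ρ(aₙ) Ω⟩`, `n ≥ 1`. -/
theorem fockMoment_cumulant {l : List A} (hl : l ≠ []) :
    fockMoment (cumulant E) l = E l.prod := by
  have h := fockMoment_sub (κ := cumulant E)
    (κ' := fun m => if _h : m.length < l.length then cumulant E m else 0) hl
    (fun m _ hm => by simp [hm])
  simp only [lt_irrefl, dite_false, sub_zero] at h
  rw [sub_eq_iff_eq_add.1 h]
  conv_lhs => rw [cumulant]
  simp

/-- The moment-cumulant formula determines the cumulants. -/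
theorem cumulant_unique {κ : List A → D}
    (hκ : ∀ l : List A, l ≠ [] → fockMoment κ l = E l.prod) :
    ∀ l : List A, l ≠ [] → κ l = cumulant E l := by
  intro l
  induction hn : l.length using Nat.strong_induction_on generalizing l with
  | _ n ih =>
    intro hl
    have h := fockMoment_sub (κ := κ) (κ' := cumulant E) hl
      (fun m h0 hm => ih m.length (hn ▸ hm) m rfl h0)
    rw [hκ l hl, fockMoment_cumulant E hl] at h
    exact sub_right_injective h

/-! ### The four conditions -/

/-- The linear spaces `P₁₁, P₁₂, P₂₁, P₂₂` (the indices `1, 2` are the elements `0, 1` of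
`Fin 2`).  Products are products of linear subspaces of `A`, i.e. spans of products of elements;
the `k`-th term of each supremum is the span of the `k`-th set of products. -/
def P (a : A) : Fin 2 → Fin 2 → Submodule ℂ A :=
  let 𝒟 : Submodule ℂ A := Subalgebra.toSubmodule D.toSubalgebra
  let x : Submodule ℂ A := Submodule.span ℂ {a}
  let y : Submodule ℂ A := Submodule.span ℂ {star a}
  let K : Submodule ℂ A := LinearMap.ker E.toLinearMap
  !![⨆ k : ℕ, 𝒟 * y * (𝒟 * x * 𝒟 * y) ^ k * 𝒟, (⨆ k : ℕ, (𝒟 * y * 𝒟 * x) ^ k * 𝒟) ⊓ K;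
    (⨆ k : ℕ, (𝒟 * x * 𝒟 * y) ^ k * 𝒟) ⊓ K, ⨆ k : ℕ, 𝒟 * x * (𝒟 * y * 𝒟 * x) ^ k * 𝒟]

/-- `E (x₁ ⋯ xₙ) = 0` for `n ≥ 1` and `x₁ ∈ P_{i₁ i₂}, …, xₙ ∈ P_{iₙ iₙ₊₁}`. -/
def MomentCondition (a : A) : Prop :=
  ∀ (n : ℕ), 1 ≤ n → ∀ (i : Fin (n + 1) → Fin 2) (x : Fin n → A),
    (∀ k : Fin n, x k ∈ P E a (i k.castSucc) (i k.succ)) →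
    E (List.ofFn x).prod = 0

/-- The sequences `(1, ⋆, …, 1, ⋆)` and `(⋆, 1, …, ⋆, 1)`. -/
def IsAlternating (s : List Letter) : Prop :=
  ∃ m : ℕ, s = (List.replicate m [Letter.one, Letter.star]).flatten ∨
    s = (List.replicate m [Letter.star, Letter.one]).flatten

/-- `κ(d₁ a^{s₁} ⊗ ⋯ ⊗ dₙ a^{sₙ}) = 0` for `n ≥ 1` unless `(s₁, …, sₙ)` is alternating; the list
`w` is `[(d₁, s₁), …, (dₙ, sₙ)]`. -/
def CumulantCondition (a : A) : Prop :=
  ∀ w : List (D × Letter), w ≠ [] → ¬ IsAlternating (w.map Prod.snd) →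
    cumulant E (w.map fun p => (p.1 : A) * letterPow a p.2) = 0

/-- `(ι(D) ⊆ B, F)` is an enlargement of `(D ⊆ A, E)`, where `A` is identified with its image
under the injective unital `*`-homomorphism `ι`. -/
def IsEnlargement {B : Type u} [Ring B] [StarRing B] [Algebra ℂ B] [StarModule ℂ B]
    (ι : A →⋆ₐ[ℂ] B) (F : CondExp (D.map ι)) : Prop :=
  Function.Injective ι ∧ ∀ x : A, (F (ι x) : B) = ι (E x : A)

/-- `u` is a scalar unitary such that `{a, a⋆}` and `{u, u⋆}` are free over `D`. -/
def IsFreeScalarUnitary (a u : A) : Prop :=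
  IsScalarVar E u ∧ u * star u = 1 ∧ star u * u = 1 ∧
    FreeOver E ![{a, star a}, {u, star u}]

/-- In some enlargement there is a scalar unitary `u`, free from `a` over `D`, with `|E(u)| < 1`
and such that `a` and `u a` are identically `D`-distributed. -/
def ExistsUnitaryCondition (a : A) : Prop :=
  ∃ (B : Type u) (_ : Ring B) (_ : StarRing B) (_ : Algebra ℂ B) (_ : StarModule ℂ B)
    (ι : A →⋆ₐ[ℂ] B) (F : CondExp (D.map ι)) (u : B),
    IsEnlargement E ι F ∧ IsFreeScalarUnitary F (ι a) u ∧
    (∃ α : ℂ, F u = algebraMap ℂ (D.map ι) α ∧ ‖α‖ < 1) ∧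
    IdentDistrib F (ι a) (u * ι a)

/-- In every enlargement and for every scalar unitary `u` free from `a` over `D`, the elements
`a` and `u a` are identically `D`-distributed. -/
def ForallUnitaryCondition (a : A) : Prop :=
  ∀ (B : Type u) [Ring B] [StarRing B] [Algebra ℂ B] [StarModule ℂ B]
    (ι : A →⋆ₐ[ℂ] B) (F : CondExp (D.map ι)) (u : B),
    IsEnlargement E ι F → IsFreeScalarUnitary F (ι a) u →
    IdentDistrib F (ι a) (u * ι a)

/-- `a` is `R`-diagonal with amalgamation over `D` if it satisfies one of the four conditions. -/
def IsRDiagonal (a : A) : Prop :=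
  MomentCondition E a ∨ CumulantCondition E a ∨
    ExistsUnitaryCondition E a ∨ ForallUnitaryCondition E a

end Basic

end OpValued

end

/-!
All conditions are compared with one statement about words `d₁ a^{s₁} ⋯ dₙ a^{sₙ}`, called `IsDiag`:
the expectation vanishes on words of odd length with alternating exponents, and on products of
centred alternating words such that each word starts with the exponent with which its predecessor
ends.  It is the moment condition, tested on words (`momentCondition_iff_isDiag`).

*Determination.*  Every word splits into maximal alternating pieces.  Expanding the product of the
centred pieces shows that, if `IsDiag` holds, the moments of all words other than the alternating
ones of even length are determined by the moments of shorter words (`IsDiag.moment_eq`).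

*Cumulants.*  The operators `ρ` act from the right on the functionals on the Fock space, so that no
tensor product over `D` is needed.  If the cumulants are supported on alternating words of even
length, then a centred alternating word of operators from `a^i` to `a^j`, applied to a tensor which
starts with the letter `a^j` or to `Ω`, only yields tensors which start with `a^i`; hence `IsDiag`
holds for the vacuum expectation (`fockSpace_isDiag`).  Conversely, by induction on `n`, the moments
of order `n` outside the alternating pattern agree with those built from the cumulants of order less
than `n`, by the determination lemma, and their difference is the cumulant of order `n`
(`cumulantCondition_iff_isDiag`).

*Unitaries.*  If `u` is a scalar unitary free from `a`, then the product of the centred words of a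
chain, taken for `u a`, is the corresponding product for `a` with `u` or `u⋆` inserted between
consecutive words.  Each inserted factor is its expectation plus a centred element.  If `IsDiag`
holds for `a`, then by freeness all terms vanish, so `IsDiag` holds for `u a`, and the distributions
agree by the determination lemma (`IsFreeScalarUnitary.identDistrib_of_isDiag`).  If conversely `a`
and `u a` are identically distributed, then by induction on the number of words only the term where
all factors are replaced with their expectations survives, so `E(x) = c E(x)` for the product `x`
of the chain and a scalar `c` with `|c| < 1`, whence `E(x) = 0`
(`IsFreeScalarUnitary.isDiag_of_identDistrib`).

*Existence of a free unitary.*  Let `u` be a self-adjoint unitary with `E(u) = 0`.  The free product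
of `A` and `D ⊕ D u` over `D` acts on a space of reduced words, in which tensor products are
replaced with spaces of `D`-linear maps `A → W`, a coinduced module; a ping-pong argument gives
freeness with respect to the vacuum expectation (`vacuumCoeff_prod_eq_zero`).  There is no positivity and so no
adjoint of operators.  The operator algebra `R` is therefore replaced with `R × R̄ᵒᵖ`, whose
involution exchanges the factors, and a further factor `A` makes the inclusion of `A` injective
(`isFreeScalarUnitary_enlarged`).
-/

noncomputable section

namespace OpValued

/-! ### Alternating words -/

/-- The other exponent. -/
def Letter.flip : Letter → Letter
  | .one => .star
  | .star => .one

@[simp] theorem Letter.flip_flip (i : Letter) : i.flip.flip = i := by cases i <;> rfl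

theorem Letter.flip_ne (i : Letter) : i.flip ≠ i := by cases i <;> simp [Letter.flip]

theorem Letter.ne_flip (i : Letter) : i ≠ i.flip := i.flip_ne.symm

theorem Letter.eq_flip_of_ne {i j : Letter} (h : i ≠ j) : i = j.flip := by
  cases i <;> cases j <;> simp_all [Letter.flip]

section Words

variable {D : Type*}

/-- The exponents in `w` alternate; the first one is `i`, and the one that would continue the
pattern after `w` is `k`.  So the last one is `k.flip`, and `w` has even length iff `k = i`. -/
def Alt : Letter → List (D × Letter) → Letter → Prop
  | i, [], k => i = k
  | i, c :: w, k => c.2 = i ∧ Alt i.flip w k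

@[simp] theorem alt_nil {i k : Letter} : Alt i ([] : List (D × Letter)) k ↔ i = k := Iff.rfl

@[simp] theorem alt_cons {i k : Letter} {c : D × Letter} {w : List (D × Letter)} :
    Alt i (c :: w) k ↔ c.2 = i ∧ Alt i.flip w k := Iff.rfl

theorem alt_append {i k : Letter} {v w : List (D × Letter)} :
    Alt i (v ++ w) k ↔ ∃ m, Alt i v m ∧ Alt m w k := by
  induction v generalizing i with
  | nil => simp
  | cons c v ih => simp [ih, and_assoc]

theorem Alt.unique {i k k' : Letter} {w : List (D × Letter)} (h : Alt i w k) (h' : Alt i w k') :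
    k = k' := by
  induction w generalizing i with
  | nil => exact h.symm.trans h'
  | cons c w ih => exact ih h.2 h'.2

theorem isAlternating_iff {w : List (D × Letter)} :
    IsAlternating (w.map Prod.snd) ↔ ∃ i, Alt i w i := by
  have key : ∀ (m : ℕ) (i : Letter) (w : List (D × Letter)),
      w.map Prod.snd = (List.replicate m [i, i.flip]).flatten → Alt i w i := by
    intro m i
    induction m with
    | zero => intro w h; simp_all
    | succ m ih =>
      intro w h
      simp only [List.replicate_succ, List.flatten_cons, List.cons_append, List.nil_append] at h
      obtain _ | ⟨c, _ | ⟨c', w⟩⟩ := w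
      · simp at h
      · simp at h
      · simp only [List.map_cons, List.cons.injEq] at h
        exact ⟨h.1, h.2.1, by simpa using ih w h.2.2⟩
  have key' : ∀ (n : ℕ) (i : Letter) (w : List (D × Letter)), w.length ≤ n → Alt i w i →
      ∃ m, w.map Prod.snd = (List.replicate m [i, i.flip]).flatten := by
    intro n i
    induction n with
    | zero =>
      intro w h _
      exact ⟨0, by simp_all⟩
    | succ n ih =>
      intro w hn h
      obtain _ | ⟨c, _ | ⟨c', w⟩⟩ := w
      · exact ⟨0, by simp⟩
      · exact absurd h.2 i.flip_ne
      · obtain ⟨h1, h2, h3⟩ := h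
        rw [Letter.flip_flip] at h3
        obtain ⟨m, hm⟩ := ih w (by simp only [List.length_cons] at hn; omega) h3
        exact ⟨m + 1, by simp [List.replicate_succ, h1, h2, hm]⟩
  constructor
  · rintro ⟨m, h | h⟩
    · exact ⟨_, key m .one w h⟩
    · exact ⟨_, key m .star w h⟩
  · rintro ⟨i, h⟩
    obtain ⟨m, hm⟩ := key' _ i w le_rfl h
    cases i
    · exact ⟨m, .inl hm⟩
    · exact ⟨m, .inr hm⟩

/-- A sequence of nonempty alternating words such that each word starts with the last exponent of
its predecessor; the first one starts with `i`, and `k` is the last exponent of the last one. -/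
def AltChain : Letter → List (List (D × Letter)) → Letter → Prop
  | i, [], k => i = k
  | i, y :: Y, k => y ≠ [] ∧ ∃ m : Letter, Alt i y m.flip ∧ AltChain m Y k

theorem altChain_append {i k : Letter} {X Y : List (List (D × Letter))} :
    AltChain i (X ++ Y) k ↔ ∃ m, AltChain i X m ∧ AltChain m Y k := by
  induction X generalizing i with
  | nil => simp [AltChain]
  | cons y X ih =>
    simp only [List.cons_append, AltChain, ih]
    constructor
    · rintro ⟨h0, m, h1, m', h2, h3⟩
      exact ⟨m', ⟨h0, m, h1, h2⟩, h3⟩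
    · rintro ⟨m', ⟨h0, m, h1, h2⟩, h3⟩
      exact ⟨h0, m, h1, m', h2, h3⟩

theorem AltChain.alt_of_mem {i k : Letter} {Y : List (List (D × Letter))} (h : AltChain i Y k)
    {y : List (D × Letter)} (hy : y ∈ Y) : y ≠ [] ∧ ∃ j m, Alt j y m := by
  induction Y generalizing i with
  | nil => simp at hy
  | cons x Y ih =>
    obtain ⟨h0, m, h1, h2⟩ := h
    rcases List.mem_cons.1 hy with rfl | hy
    · exact ⟨h0, i, _, h1⟩
    · exact ih h2 hy

/-- Every nonempty word splits into maximal alternating pieces. -/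
theorem exists_altChain (c : D × Letter) (w : List (D × Letter)) :
    ∃ (y : List (D × Letter)) (Y : List (List (D × Letter))) (k : Letter),
      AltChain c.2 (y :: Y) k ∧ (y :: Y).flatten = c :: w := by
  induction w generalizing c with
  | nil => exact ⟨[c], [], c.2, ⟨by simp, c.2, by simp, rfl⟩, by simp⟩
  | cons b w ih =>
    obtain ⟨y, Y, k, ⟨h0, m, h1, h2⟩, h3⟩ := ih b
    by_cases hcb : c.2 = b.2
    · exact ⟨[c], y :: Y, k, ⟨by simp, c.2, by simp, h0, m, hcb ▸ h1, h2⟩, by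
        simpa using h3⟩
    · refine ⟨c :: y, Y, k, ⟨by simp, m, ⟨rfl, ?_⟩, h2⟩, by simpa using h3⟩
      rwa [← Letter.eq_flip_of_ne (Ne.symm hcb)]

variable [Ring D]

/-- Multiplication of a word `d₁ x^{s₁} ⋯ dₙ x^{sₙ}` by `d` from the left. -/
def scale (d : D) : List (D × Letter) → List (D × Letter)
  | [] => []
  | c :: w => (d * c.1, c.2) :: w

@[simp] theorem scale_nil (d : D) : scale d [] = [] := rfl

@[simp] theorem scale_cons (d : D) (c : D × Letter) (w : List (D × Letter)) :
    scale d (c :: w) = (d * c.1, c.2) :: w := rfl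

@[simp] theorem length_scale (d : D) (w : List (D × Letter)) :
    (scale d w).length = w.length := by cases w <;> rfl

@[simp] theorem alt_scale {d : D} {w : List (D × Letter)} {i k : Letter} :
    Alt i (scale d w) k ↔ Alt i w k := by cases w <;> simp

@[simp] theorem scale_eq_nil {d : D} {w : List (D × Letter)} : scale d w = [] ↔ w = [] := by
  cases w <;> simp

end Words

/-! ### Algebraic `D`-valued probability spaces with two marked elements -/

/-- An algebraic `D`-valued probability space without involution, with two marked elements which
play the roles of `a` and `a⋆`.  The copy of `D` in `B` need not be faithful. -/
structure TwoLetterSpace (D B : Type*) [Ring D] [Ring B] where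
  emb : D →+* B
  exp : B →+ D
  exp_one : exp 1 = 1
  exp_emb_mul : ∀ d b, exp (emb d * b) = d * exp b
  exp_mul_emb : ∀ b d, exp (b * emb d) = exp b * d
  letter : Letter → B

namespace TwoLetterSpace

variable {D B B' : Type*} [Ring D] [Ring B] [Ring B']
variable (M : TwoLetterSpace D B) (M' : TwoLetterSpace D B')

/-- The value `d₁ x^{s₁} ⋯ dₙ x^{sₙ}` of the word `[(d₁, s₁), …, (dₙ, sₙ)]`. -/
def ev (w : List (D × Letter)) : B := (w.map fun c => M.emb c.1 * M.letter c.2).prod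

/-- The expectation of the value of a word. -/
def moment (w : List (D × Letter)) : D := M.exp (M.ev w)

/-- The value of a word, minus its expectation. -/
def centred (w : List (D × Letter)) : B := M.ev w - M.emb (M.moment w)

@[simp] theorem ev_nil : M.ev [] = 1 := rfl

@[simp] theorem ev_cons (c : D × Letter) (w : List (D × Letter)) :
    M.ev (c :: w) = M.emb c.1 * M.letter c.2 * M.ev w := by simp [ev]

@[simp] theorem ev_append (v w : List (D × Letter)) : M.ev (v ++ w) = M.ev v * M.ev w := by
  simp [ev]

theorem ev_scale (d : D) {w : List (D × Letter)} (hw : w ≠ []) :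
    M.ev (scale d w) = M.emb d * M.ev w := by
  cases w with
  | nil => exact absurd rfl hw
  | cons c w => simp [mul_assoc]

theorem exp_emb (d : D) : M.exp (M.emb d) = d := by
  simpa [M.exp_one] using M.exp_emb_mul d 1

theorem moment_scale (d : D) {w : List (D × Letter)} (hw : w ≠ []) :
    M.moment (scale d w) = d * M.moment w := by
  rw [moment, M.ev_scale d hw, M.exp_emb_mul, moment]

theorem exp_centred (w : List (D × Letter)) : M.exp (M.centred w) = 0 := by
  simp [centred, M.exp_emb, moment]

theorem centred_scale (d : D) {w : List (D × Letter)} (hw : w ≠ []) :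
    M.centred (scale d w) = M.emb d * M.centred w := by
  simp [centred, M.ev_scale d hw, M.moment_scale d hw, mul_sub]

/-- The moments of the two marked elements are those of an `R`-diagonal element: the expectation
vanishes on alternating words of odd length and on products of centred alternating words in
which neighbouring exponents of different words agree. -/
structure IsDiag : Prop where
  odd : ∀ (i : Letter) (y : List (D × Letter)), Alt i y i.flip → M.moment y = 0
  chain : ∀ (i k : Letter) (Y : List (List (D × Letter))), Y ≠ [] → AltChain i Y k →
    M.exp (Y.map M.centred).prod = 0

variable {M M'}

theorem exp_ev_emb_ev_congr {n : ℕ} (h : ∀ w, w.length < n → M.moment w = M'.moment w)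
    (v w : List (D × Letter)) (d : D) (hn : v.length + w.length < n) :
    M.exp (M.ev v * M.emb d * M.ev w) = M'.exp (M'.ev v * M'.emb d * M'.ev w) := by
  obtain rfl | hw := eq_or_ne w []
  · simp only [ev_nil, mul_one, exp_mul_emb]
    exact congrArg (· * d) (h v (by simpa using hn))
  · rw [mul_assoc, ← M.ev_scale d hw, ← M.ev_append, mul_assoc, ← M'.ev_scale d hw,
      ← M'.ev_append]
    exact h _ (by simpa using hn)

/-- Up to words of fewer than `n` letters, a product of centred words is the product of the words
themselves. -/
theorem exp_prod_centred_sub {n : ℕ} (h : ∀ w, w.length < n → M.moment w = M'.moment w)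
    (Y : List (List (D × Letter))) (hY : ∀ y ∈ Y, y ≠ [] ∧ M.moment y = M'.moment y) :
    ∀ (v : List (D × Letter)) (d : D), v.length + Y.flatten.length ≤ n →
      M.exp (M.ev v * M.emb d * (Y.map M.centred).prod) -
          M'.exp (M'.ev v * M'.emb d * (Y.map M'.centred).prod) =
        M.exp (M.ev v * M.emb d * M.ev Y.flatten) -
          M'.exp (M'.ev v * M'.emb d * M'.ev Y.flatten) := by
  induction Y with
  | nil => simp
  | cons y Y ih =>
    intro v d hn
    obtain ⟨hy, hm⟩ := hY y (by simp)
    have ih' := ih fun z hz => hY z (by simp [hz])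
    simp only [List.flatten_cons, List.length_append] at hn
    have hpos := List.length_pos_iff.2 hy
    have h1 := ih' (v ++ scale d y) 1 (by rw [List.length_append, length_scale]; omega)
    have h2 := ih' v (d * M.moment y) (by omega)
    rw [exp_ev_emb_ev_congr h v Y.flatten _ (by omega), sub_self] at h2
    have e1 : M.ev v * M.emb d * ((y :: Y).map M.centred).prod =
        M.ev (v ++ scale d y) * M.emb 1 * (Y.map M.centred).prod -
          M.ev v * M.emb (d * M.moment y) * (Y.map M.centred).prod := by
      simp [centred, M.ev_scale d hy]; noncomm_ring
    have e2 : M'.ev v * M'.emb d * ((y :: Y).map M'.centred).prod =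
        M'.ev (v ++ scale d y) * M'.emb 1 * (Y.map M'.centred).prod -
          M'.ev v * M'.emb (d * M.moment y) * (Y.map M'.centred).prod := by
      simp [centred, M'.ev_scale d hy, hm]; noncomm_ring
    rw [e1, e2, map_sub, map_sub, sub_sub_sub_comm, h1, h2, sub_zero]
    simp [M.ev_scale d hy, M'.ev_scale d hy, mul_assoc]

/-- `R`-diagonality computes the moments of all words other than the alternating ones of even
length from the moments of shorter words. -/
theorem IsDiag.moment_eq {n : ℕ} (hM : M.IsDiag) (hM' : M'.IsDiag)
    (h : ∀ w, w.length < n → M.moment w = M'.moment w) (w : List (D × Letter))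
    (hn : w.length = n) (hw : ∀ i, Alt i w i → M.moment w = M'.moment w) :
    M.moment w = M'.moment w := by
  obtain _ | ⟨c, w⟩ := w
  · exact hw .one rfl
  obtain ⟨y, Y, k, hch, hfl⟩ := exists_altChain c w
  have hY : ∀ z ∈ y :: Y, z ≠ [] ∧ M.moment z = M'.moment z := by
    intro z hz
    obtain ⟨hz0, j, m, hjm⟩ := hch.alt_of_mem hz
    refine ⟨hz0, ?_⟩
    by_cases hmj : m = j
    · obtain ⟨s, t, hst⟩ := List.append_of_mem hz
      rw [← hfl, hst] at hn hw
      simp only [List.flatten_append, List.flatten_cons, List.length_append] at hn hw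
      by_cases hlt : z.length < n
      · exact h z hlt
      · have hs : s.flatten = [] := List.length_eq_zero_iff.1 (by omega)
        have ht : t.flatten = [] := List.length_eq_zero_iff.1 (by omega)
        rw [hs, ht] at hw
        simp only [List.nil_append, List.append_nil] at hw
        exact hw j (hmj ▸ hjm)
    · rw [Letter.eq_flip_of_ne hmj] at hjm
      rw [hM.odd j z hjm, hM'.odd j z hjm]
  have key := exp_prod_centred_sub h (y :: Y) hY [] 1 (by
    rw [hfl, ← hn]; simp)
  simp only [ev_nil, map_one, one_mul, hM.chain _ _ _ (by simp) hch,
    hM'.chain _ _ _ (by simp) hch, sub_self, hfl] at key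
  exact sub_eq_zero.1 key.symm

/-- The determination lemma of `IsDiag.moment_eq` without the bookkeeping of lengths. -/
theorem IsDiag.moment_eq_of_alt (hM : M.IsDiag) (hM' : M'.IsDiag)
    (h : ∀ i w, Alt i w i → M.moment w = M'.moment w) (w : List (D × Letter)) :
    M.moment w = M'.moment w := by
  induction hn : w.length using Nat.strong_induction_on generalizing w with
  | _ n ih => exact hM.moment_eq hM' (fun v hv => ih _ hv v rfl) w hn fun i => h i w

/-- Expectations of products of centred words only depend on the moments. -/
theorem exp_prod_centred_congr (h : ∀ w, M.moment w = M'.moment w)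
    (Y : List (List (D × Letter))) (hY : ∀ y ∈ Y, y ≠ []) :
    M.exp (Y.map M.centred).prod = M'.exp (Y.map M'.centred).prod := by
  have key := exp_prod_centred_sub (n := Y.flatten.length) (fun w _ => h w) Y
    (fun y hy => ⟨hY y hy, h y⟩) [] 1 (by simp)
  have h' : M.exp (M.ev Y.flatten) = M'.exp (M'.ev Y.flatten) := h _
  simpa [h', sub_eq_zero] using key

end TwoLetterSpace

theorem Alt.start_unique {D : Type*} {i i' k k' : Letter} {w : List (D × Letter)}
    (h : Alt i w k) (h' : Alt i' w k') (hw : w ≠ []) : i = i' := by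
  cases w with
  | nil => exact absurd rfl hw
  | cons c w => exact h.1.symm.trans h'.1

theorem Alt.length_mod_two {D : Type*} {i : Letter} {w : List (D × Letter)} :
    (Alt i w i → w.length % 2 = 0) ∧ (Alt i w i.flip → w.length % 2 = 1) := by
  induction w generalizing i with
  | nil => simp [Letter.ne_flip]
  | cons c w ih =>
    have := ih (i := i.flip)
    rw [Letter.flip_flip] at this
    simp only [alt_cons, List.length_cons]
    exact ⟨fun h => by have := this.2 h.2; omega, fun h => by have := this.1 h.2; omega⟩

section Functionals

variable {D : Type*} [Ring D]

/-- Additivity in the coefficient of each letter of a word. -/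
def SlotAdd (T : List (D × Letter) → D) : Prop :=
  ∀ (v : List (D × Letter)) (d d' : D) (s : Letter) (w : List (D × Letter)),
    T (v ++ (d + d', s) :: w) = T (v ++ (d, s) :: w) + T (v ++ (d', s) :: w)

variable (D) in
/-- The dual of the free Fock space over the letters `d a^s`: right `D`-linear functionals on it,
given by their values on elementary tensors, and additive in each tensor factor. -/
def Functionals : Submodule D (List (D × Letter) → D) where
  carrier := {T | SlotAdd T}
  add_mem' {S T} hS hT v d d' s w := by
    simp only [Pi.add_apply, hS v d d' s w, hT v d d' s w]; abel
  zero_mem' v d d' s w := by simp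
  smul_mem' e T hT v d d' s w := by
    simp only [Pi.smul_apply, hT v d d' s w, smul_add]

/-- The functional `v ↦ T (d v)`. -/
def act (T : List (D × Letter) → D) (d : D) : List (D × Letter) → D
  | [] => T [] * d
  | c :: w => T ((d * c.1, c.2) :: w)

/-- The annihilation part of the transpose of `ρ`: the sum of `T (κ(p ⊗ w₁) w₂)` over all
decompositions of `w` into a prefix `w₁` and a suffix `w₂`. -/
def annih (κ T : List (D × Letter) → D) :
    List (D × Letter) → List (D × Letter) → D
  | p, [] => act T (κ p) []
  | p, b :: w => act T (κ p) (b :: w) + annih κ T (p ++ [b]) w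

/-- The transpose of `ρ(c)`. -/
def rhoDual (κ T : List (D × Letter) → D) (c : D × Letter) (w : List (D × Letter)) : D :=
  T (c :: w) + annih κ T [c] w

/-- The vacuum functional. -/
def vac : List (D × Letter) → D
  | [] => 1
  | _ :: _ => 0

variable {κ T : List (D × Letter) → D}

theorem act_one (T : List (D × Letter) → D) (w : List (D × Letter)) : act T 1 w = T w := by
  cases w <;> simp [act]

theorem act_act (T : List (D × Letter) → D) (d e : D) : act (act T d) e = act T (d * e) := by
  funext w; cases w <;> simp [act, mul_assoc]

theorem act_scale (T : List (D × Letter) → D) (d e : D) {w : List (D × Letter)} (hw : w ≠ []) :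
    act T d (scale e w) = act T (d * e) w := by
  cases w with
  | nil => exact absurd rfl hw
  | cons c w => simp [act, mul_assoc]

theorem act_eq_scale (T : List (D × Letter) → D) (d : D) {w : List (D × Letter)} (hw : w ≠ []) :
    act T d w = T (scale d w) := by
  cases w with
  | nil => exact absurd rfl hw
  | cons c w => simp [act]

theorem SlotAdd.act_add (hT : SlotAdd T) (d e : D) (w : List (D × Letter)) :
    act T (d + e) w = act T d w + act T e w := by
  cases w with
  | nil => simp [act, mul_add]
  | cons c w => simpa [act, add_mul] using hT [] (d * c.1) (e * c.1) c.2 w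

theorem SlotAdd.act_zero (hT : SlotAdd T) (w : List (D × Letter)) : act T 0 w = 0 := by
  simpa using hT.act_add 0 0 w

theorem SlotAdd.act (hT : SlotAdd T) (e : D) : SlotAdd (act T e) := by
  intro v d d' s w
  cases v with
  | nil => simpa [OpValued.act, mul_add] using hT [] (e * d) (e * d') s w
  | cons c v => exact hT ((e * c.1, c.2) :: v) d d' s w

theorem slotAdd_vac : SlotAdd (vac : List (D × Letter) → D) := by
  intro v d d' s w
  cases v <;> simp [vac]

theorem act_add_left (S T : List (D × Letter) → D) (d : D) :
    act (S + T) d = act S d + act T d := by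
  funext w; cases w <;> simp [act, add_mul]

theorem act_smul_left (T : List (D × Letter) → D) (d e : D) :
    act (e • T) d = e • act T d := by
  funext w; cases w <;> simp [act, mul_assoc]

theorem act_vac (d : D) : act vac d = d • vac := by
  funext w; cases w <;> simp [act, vac]

theorem annih_eq (κ T : List (D × Letter) → D) (p w : List (D × Letter)) :
    annih κ T p w = act T (κ p) w + (match w with
      | [] => 0
      | b :: w => annih κ T (p ++ [b]) w) := by
  cases w <;> simp [annih]

theorem annih_add_left (κ S T : List (D × Letter) → D) (p w : List (D × Letter)) :
    annih κ (S + T) p w = annih κ S p w + annih κ T p w := by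
  induction w generalizing p with
  | nil => simp only [annih, act_add_left, Pi.add_apply]
  | cons b w ih => simp only [annih, act_add_left, Pi.add_apply, ih]; abel

theorem annih_smul_left (κ T : List (D × Letter) → D) (e : D) (p w : List (D × Letter)) :
    annih κ (e • T) p w = e * annih κ T p w := by
  induction w generalizing p with
  | nil => simp only [annih, act_smul_left, Pi.smul_apply, smul_eq_mul]
  | cons b w ih => simp only [annih, act_smul_left, Pi.smul_apply, smul_eq_mul, ih, mul_add]

/-- Additivity of the annihilation part in a factor that has already been absorbed. -/
theorem annih_slotAdd_left (hκ : SlotAdd κ) (hT : SlotAdd T) (p : List (D × Letter)) (d d' : D)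
    (s : Letter) (q w : List (D × Letter)) :
    annih κ T (p ++ (d + d', s) :: q) w =
      annih κ T (p ++ (d, s) :: q) w + annih κ T (p ++ (d', s) :: q) w := by
  induction w generalizing q with
  | nil => simp only [annih, hκ p d d' s q, hT.act_add]
  | cons b w ih =>
    simp only [annih, hκ p d d' s q, hT.act_add, List.append_assoc, List.cons_append, ih]
    abel

/-- Additivity of the annihilation part in a factor that has not yet been absorbed. -/
theorem annih_slotAdd_right (hκ : SlotAdd κ) (hT : SlotAdd T) (p v : List (D × Letter)) (d d' : D)
    (s : Letter) (w : List (D × Letter)) :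
    annih κ T p (v ++ (d + d', s) :: w) =
      annih κ T p (v ++ (d, s) :: w) + annih κ T p (v ++ (d', s) :: w) := by
  induction v generalizing p with
  | nil =>
    simp only [List.nil_append, annih, annih_slotAdd_left hκ hT p d d' s [] w]
    have := hT.act (κ p) [] d d' s w
    simp only [List.nil_append] at this
    rw [this]; abel
  | cons b v ih =>
    have := hT.act (κ p) (b :: v) d d' s w
    simp only [List.cons_append] at this
    simp only [List.cons_append, annih, ih, this]; abel

/-- `T ρ(c)`, as a functional, and as a function of `T`. -/
def rhoLin (κ : List (D × Letter) → D) (hκ : SlotAdd κ) (c : D × Letter) :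
    Module.End D (Functionals D) where
  toFun T := ⟨rhoDual κ T.1 c, fun v d d' s w => by
    have h1 := T.2 (c :: v) d d' s w
    simp only [List.cons_append] at h1
    simp only [rhoDual, h1, annih_slotAdd_right hκ T.2]; abel⟩
  map_add' S T := by
    ext w; simp only [rhoDual, Submodule.coe_add, Pi.add_apply, annih_add_left]; abel
  map_smul' e T := by
    ext w
    simp only [rhoDual, Submodule.coe_smul, Pi.smul_apply, annih_smul_left, RingHom.id_apply,
      smul_eq_mul, mul_add]

/-- `T ↦ T d`, as a linear map. -/
def actLin (d : D) : Module.End D (Functionals D) where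
  toFun T := ⟨act T.1 d, T.2.act d⟩
  map_add' S T := by ext w; simp only [Submodule.coe_add, act_add_left]
  map_smul' e T := by ext w; simp only [Submodule.coe_smul, act_smul_left, RingHom.id_apply]

/-- The vacuum functional as an element of the dual Fock space. -/
def vacFun : Functionals D := ⟨vac, slotAdd_vac⟩

/-- The algebra of operators on the dual Fock space, acting from the right, with the vacuum
expectation; the marked elements are `ρ(a)` and `ρ(a⋆)`, built from prescribed cumulants `κ`. -/
def fockSpace (κ : List (D × Letter) → D) (hκ : SlotAdd κ) :
    TwoLetterSpace D (Module.End D (Functionals D))ᵐᵒᵖ where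
  emb :=
    { toFun := fun d => .op (actLin d)
      map_one' := by
        apply MulOpposite.unop_injective
        ext T w; exact act_one T.1 w
      map_mul' := fun d e => by
        apply MulOpposite.unop_injective
        ext T w; exact congrFun (act_act T.1 d e).symm w
      map_zero' := by
        apply MulOpposite.unop_injective
        ext T w; exact T.2.act_zero w
      map_add' := fun d e => by
        apply MulOpposite.unop_injective
        ext T w; exact T.2.act_add d e w }
  exp :=
    { toFun := fun X => (X.unop vacFun).1 []
      map_zero' := rfl
      map_add' := fun X Y => rfl }
  exp_one := rfl
  exp_emb_mul d X := by
    change (X.unop (actLin d vacFun)).1 [] = d * (X.unop vacFun).1 []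
    have : actLin d (vacFun : Functionals D) = d • vacFun := by
      ext w; exact congrFun (act_vac d) w
    rw [this, map_smul]; rfl
  exp_mul_emb X d := rfl
  letter s := .op (rhoLin κ hκ (1, s))

/-- Left `D`-linearity `κ(d a₁ ⊗ ⋯ ⊗ aₙ) = d κ(a₁ ⊗ ⋯ ⊗ aₙ)`. -/
def LeftLin (κ : List (D × Letter) → D) : Prop :=
  ∀ d w, w ≠ [] → κ (scale d w) = d * κ w

theorem annih_act (hκ : LeftLin κ) (d : D) (c : D × Letter) (p w : List (D × Letter)) :
    annih κ (act T d) (c :: p) w = annih κ T ((d * c.1, c.2) :: p) w := by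
  have h (q : List (D × Letter)) : κ ((d * c.1, c.2) :: q) = d * κ (c :: q) :=
    hκ d (c :: q) (by simp)
  induction w generalizing p with
  | nil => simp only [annih, act_act, h]
  | cons b w ih => simp only [annih, act_act, h, List.cons_append, ih]

section FockSpace

variable (h : SlotAdd κ) (hl : LeftLin κ)
include hl

theorem fockSpace_ev_cons_apply (c : D × Letter) (w : List (D × Letter)) (T : Functionals D) :
    ((fockSpace κ h).ev (c :: w)).unop T = ((fockSpace κ h).ev w).unop (rhoLin κ h c T) := by
  have : rhoLin κ h (1, c.2) (actLin c.1 T) = rhoLin κ h c T := by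
    ext v
    change act T.1 c.1 ((1, c.2) :: v) + annih κ (act T.1 c.1) [(1, c.2)] v =
      T.1 (c :: v) + annih κ T.1 [c] v
    rw [annih_act hl]
    simp [act]
  rw [TwoLetterSpace.ev_cons, MulOpposite.unop_mul, Module.End.mul_apply, ← this]
  rfl

theorem fockSpace_ev_apply_coe (w : List (D × Letter)) (T : Functionals D) :
    (((fockSpace κ h).ev w).unop T).1 = w.foldl (rhoDual κ) T.1 := by
  induction w generalizing T with
  | nil => rfl
  | cons c w ih => rw [fockSpace_ev_cons_apply h hl, ih]; rfl

theorem fockSpace_moment (w : List (D × Letter)) :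
    (fockSpace κ h).moment w = w.foldl (rhoDual κ) vac [] :=
  congrFun (fockSpace_ev_apply_coe h hl w vacFun) []

end FockSpace

/-! ### Cumulants supported on alternating words -/

theorem annih_eq_zero {S : List (D × Letter) → D} (hS : SlotAdd S) (p w : List (D × Letter))
    (h : ∀ r, κ (p ++ r) = 0) : annih κ S p w = 0 := by
  induction w generalizing p with
  | nil => simp [annih, act, show κ p = 0 by simpa using h []]
  | cons b w ih =>
    rw [annih, ih (p ++ [b]) (fun r => by simpa using h (b :: r)),
      show κ p = 0 by simpa using h [], hS.act_zero, add_zero]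

/-- The cumulants vanish except on alternating words of even length. -/
def AltSupported (κ : List (D × Letter) → D) : Prop :=
  ∀ w, w ≠ [] → κ w ≠ 0 → ∃ i, Alt i w i

section AltSupported

variable (h : SlotAdd κ) (hl : LeftLin κ) (hs : AltSupported κ)
include hl hs

/-- If the word `C` alternates and starts with `i`, then the operator `ρ(C)` acts on a vector `w`
that starts with the last letter of `C` by `ρ(C) w = (ρ(C) Ω) ⊗ w`, since no cumulant can
connect `C` to `w`; the nonvacuum part of `ρ(C) Ω` consists of tensors which start with `i`, and
so is annihilated by `T`.  For the induction, `v` is a part of `C` that has already been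
applied. -/
theorem fockSpace_apply_append {i j : Letter} (T : Functionals D)
    (hT : ∀ c w, c.2 = i → T.1 (c :: w) = 0) (w : List (D × Letter))
    (hw : ∀ c w', w = c :: w' → c.2 = j) (C : List (D × Letter)) :
    ∀ m, Alt i C m → ∀ v, Alt m v j.flip →
      (((fockSpace κ h).ev C).unop T).1 (v ++ w) =
        act T.1 ((((fockSpace κ h).ev C).unop vacFun).1 v) w := by
  induction C using List.reverseRecOn generalizing w with
  | nil =>
    rintro m rfl v hv
    obtain _ | ⟨c, v⟩ := v
    · exact (act_one T.1 w).symm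
    · change T.1 (c :: (v ++ w)) = act T.1 0 w
      rw [T.2.act_zero, hT c _ hv.1]
  | append_singleton C c ih =>
    intro m hC v hv
    obtain ⟨m', hC', hc, rfl⟩ := alt_append.1 hC
    have happ (T : Functionals D) : (((fockSpace κ h).ev (C ++ [c])).unop T).1 =
        rhoDual κ (((fockSpace κ h).ev C).unop T).1 c := by
      rw [fockSpace_ev_apply_coe h hl, fockSpace_ev_apply_coe h hl, List.foldl_append]; rfl
    rw [happ, happ]
    replace ih := fun w hw v => ih w hw m' hC' v
    generalize ((fockSpace κ h).ev C).unop T = S at ih ⊢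
    generalize ((fockSpace κ h).ev C).unop vacFun = S₀ at ih ⊢
    have key : ∀ (v p : List (D × Letter)) (q : Letter), p ≠ [] → Alt m' p q → Alt q v j.flip →
        annih κ S.1 p (v ++ w) = act T.1 (annih κ S₀.1 p v) w := by
      intro v
      induction v with
      | nil =>
        rintro p q hp hpq rfl
        have h1 : annih κ S.1 p w = act S.1 (κ p) w := by
          rw [annih_eq]
          obtain _ | ⟨b, w⟩ := w
          · simp
          · refine add_eq_left.2 (annih_eq_zero S.2 _ _ fun r => ?_)
            by_contra hne
            obtain ⟨i', hi'⟩ := hs _ (by simp) hne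
            rw [List.append_assoc] at hi'
            obtain ⟨q', hq', hb, -⟩ := alt_append.1 hi'
            rw [hpq.start_unique hq' hp] at hpq
            exact j.flip_ne ((hpq.unique hq').trans (hb.symm.trans (hw b w rfl)))
        rw [List.nil_append, h1, annih]
        by_cases hκ : κ p = 0
        · rw [hκ, S.2.act_zero, S₀.2.act_zero, T.2.act_zero]
        · obtain ⟨i', hi'⟩ := hs _ hp hκ
          have hm : m' = j.flip := by
            obtain rfl := hi'.start_unique hpq hp
            exact hi'.unique hpq
          obtain rfl | hw0 := eq_or_ne w []
          · have := ih [] (by simp) [] hm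
            simp only [List.append_nil, act] at this ⊢
            rw [this, mul_assoc]
          · have := ih (scale (κ p) w) (by
              intro c' w' hc'
              obtain _ | ⟨c, w⟩ := w
              · simp at hc'
              · simp only [scale_cons, List.cons.injEq] at hc'
                rw [← hc'.1]; exact hw c w rfl) [] hm
            rw [act_scale _ _ _ hw0, List.nil_append] at this
            rw [act_eq_scale _ _ hw0, this]; rfl
      | cons b v ihv =>
        intro p q hp hpq hv
        rw [List.cons_append, annih, annih, T.2.act_add,
          ihv (p ++ [b]) q.flip (by simp) (alt_append.2 ⟨q, hpq, hv.1, rfl⟩) hv.2]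
        congr 1
        by_cases hκ : κ p = 0
        · rw [hκ, S.2.act_zero, S₀.2.act_zero, T.2.act_zero]
        · obtain ⟨i', hi'⟩ := hs _ hp hκ
          obtain rfl := hi'.start_unique hpq hp
          obtain rfl := hi'.unique hpq
          exact ih w hw ((κ p * b.1, b.2) :: v) hv
    rw [rhoDual, rhoDual, T.2.act_add, key v [c] _ (by simp) ⟨hc, rfl⟩ hv]
    congr 1
    exact ih w hw (c :: v) ⟨hc, hv⟩

/-- Words of odd length have no vacuum expectation, since cumulants of odd order vanish. -/
theorem fockSpace_apply_eq_zero_of_parity (C : List (D × Letter)) :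
    ∀ (T : Functionals D) (ε : ℕ), (∀ w, w.length % 2 ≠ ε % 2 → T.1 w = 0) →
      ∀ w, (w.length + C.length) % 2 ≠ ε % 2 → (((fockSpace κ h).ev C).unop T).1 w = 0 := by
  induction C with
  | nil => exact fun T ε hT w hw => hT w hw
  | cons c C ih =>
    intro T ε hT w hw
    rw [fockSpace_ev_cons_apply h hl]
    refine ih _ (ε + 1) ?_ w (by simp only [List.length_cons] at hw; omega)
    intro w hw
    have hann : ∀ w p : List (D × Letter), p ≠ [] → (p.length + w.length) % 2 ≠ ε % 2 →
        annih κ T.1 p w = 0 := by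
      intro w
      induction w with
      | nil =>
        intro p hp hlen
        rw [annih, act]
        by_cases hκ : κ p = 0
        · rw [hκ, mul_zero]
        · obtain ⟨i, hi⟩ := hs p hp hκ
          have := Alt.length_mod_two.1 hi
          rw [hT [] (by simp only [List.length_nil] at *; omega), zero_mul]
      | cons b w ihw =>
        intro p hp hlen
        rw [annih, ihw _ (by simp) (by
          simp only [List.length_append, List.length_cons, List.length_nil] at *; omega),
          add_zero, act]
        by_cases hκ : κ p = 0
        · rw [hκ]
          exact T.2.act_zero (b :: w)
        · obtain ⟨i, hi⟩ := hs p hp hκ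
          have := Alt.length_mod_two.1 hi
          exact hT _ (by simp only [List.length_cons] at *; omega)
    change T.1 (c :: w) + annih κ T.1 [c] w = 0
    rw [hT (c :: w) (by simp only [List.length_cons]; omega),
      hann w [c] (by simp) (by simp only [List.length_cons, List.length_nil]; omega), add_zero]

/-- If `T` annihilates the tensors which start with `i`, then `T ρ(y)°`, for a centred alternating
word `ρ(y)°` from `i` to `j`, annihilates `Ω` and the tensors which start with `j`. -/
theorem fockSpace_centred_apply {i j : Letter} {y : List (D × Letter)} (hy : Alt i y j.flip)
    (T : Functionals D) (hT : ∀ c w, c.2 = i → T.1 (c :: w) = 0) (w : List (D × Letter))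
    (hw : ∀ c w', w = c :: w' → c.2 = j) :
    (((fockSpace κ h).centred y).unop T).1 w = 0 := by
  have key := fockSpace_apply_append h hl hs T hT w hw y _ hy [] rfl
  exact sub_eq_zero.2 key

theorem fockSpace_isDiag : (fockSpace κ h).IsDiag where
  odd i y hy := by
    have := Alt.length_mod_two.2 hy
    refine fockSpace_apply_eq_zero_of_parity h hl hs y vacFun 0 ?_ [] (by simp [this])
    intro w hw
    cases w with
    | nil => simp at hw
    | cons c w => rfl
  chain i k Y hY hch := by
    have key : ∀ (Y : List (List (D × Letter))) (i : Letter), AltChain i Y k →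
        ∀ T : Functionals D, (∀ c w, c.2 = i → T.1 (c :: w) = 0) → (Y = [] → T.1 [] = 0) →
          ((Y.map (fockSpace κ h).centred).prod.unop T).1 [] = 0 := by
      intro Y
      induction Y with
      | nil => exact fun i _ T _ h0 => h0 rfl
      | cons y Y ih =>
        rintro i ⟨-, m, h1, h2⟩ T hT -
        refine ih m h2 (((fockSpace κ h).centred y).unop T) ?_ fun _ => ?_
        · rintro c w hc
          exact fockSpace_centred_apply h hl hs h1 T hT _ (by rintro _ _ ⟨⟩; exact hc)
        · exact fockSpace_centred_apply h hl hs h1 T hT [] (by simp)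
    exact key Y i hch vacFun (fun c w _ => rfl) (fun h => absurd h hY)

end AltSupported

end Functionals

/-! ### Moments and cumulants of an element -/

section Element

variable {A : Type u} [Ring A] [StarRing A] [Algebra ℂ A] [StarModule ℂ A]
variable {D : StarSubalgebra ℂ A} (E : CondExp D)

theorem CondExp.map_one (E : CondExp D) : E 1 = 1 := E.map_one'

theorem CondExp.map_mul_left (E : CondExp D) (d : D) (x : A) : E ((d : A) * x) = d * E x := by
  simpa using E.map_bimod' d 1 x

theorem CondExp.map_mul_right (E : CondExp D) (x : A) (d : D) : E (x * (d : A)) = E x * d := by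
  simpa using E.map_bimod' 1 d x

theorem CondExp.map_coe (E : CondExp D) (d : D) : E (d : A) = d := by
  simpa [E.map_one] using E.map_mul_left d 1

theorem CondExp.map_star (E : CondExp D) (x : A) : E (star x) = star (E x) := E.map_star' x

/-- The probability space `(D ⊆ A, E)` with a marked pair of elements. -/
def CondExp.marked (E : CondExp D) (x : Letter → A) : TwoLetterSpace D A where
  emb := (D.subtype : D →⋆ₐ[ℂ] A)
  exp := E.toLinearMap
  exp_one := E.map_one
  exp_emb_mul := E.map_mul_left
  exp_mul_emb := E.map_mul_right
  letter := x

@[simp] theorem CondExp.marked_emb (x : Letter → A) (d : D) : (E.marked x).emb d = (d : A) := rfl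

@[simp] theorem CondExp.marked_exp (x : Letter → A) (y : A) : (E.marked x).exp y = E y := rfl

@[simp] theorem CondExp.marked_letter (x : Letter → A) (s : Letter) :
    (E.marked x).letter s = x s := rfl

/-- The factor `d x^s` of a word. -/
def evLetter (x : Letter → A) (c : D × Letter) : A := (c.1 : A) * x c.2

theorem CondExp.marked_moment (x : Letter → A) (w : List (D × Letter)) :
    (E.marked x).moment w = E (w.map (evLetter x)).prod := rfl

theorem identDistrib_iff (x y : A) :
    IdentDistrib E x y ↔ ∀ w : List (D × Letter),
      (E.marked (letterPow x)).moment w = (E.marked (letterPow y)).moment w := by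
  constructor
  · rintro h (_ | ⟨c, w⟩)
    · rfl
    · simp only [CondExp.marked_moment, List.map_cons, List.prod_cons, evLetter, mul_assoc,
        CondExp.map_mul_left]
      exact congrArg (c.1 * ·) (h c.2 w)
  · intro h s w
    have := h ((1, s) :: w)
    simp only [CondExp.marked_moment, List.map_cons, List.prod_cons, evLetter, mul_assoc,
      CondExp.map_mul_left, one_mul] at this
    exact this

section FockMoment

/-- The pairing of a functional with a formal Fock space vector. -/
def pairing (T : List A → D) (v : List (List A × D)) : D := (v.map fun q => T q.1 * q.2).sum

theorem pairing_flatMap_rho (κ T : List A → D) (a : A) (v : List (List A × D)) :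
    pairing T (v.flatMap (rho κ a)) = pairing (fun w => T (a :: w) + (T [] * κ (a :: w) +
      ((List.finRange w.length).map fun i : Fin w.length =>
        T ((κ (a :: w.take i) : A) * w.get i :: w.drop ((i : ℕ) + 1))).sum)) v := by
  induction v with
  | nil => rfl
  | cons q v ih =>
    simp only [pairing, List.flatMap_cons, List.map_append, List.sum_append] at ih ⊢
    rw [ih, List.map_cons, List.sum_cons]
    congr 1
    simp only [rho, List.map_cons, List.sum_cons, List.map_map, Function.comp_def, add_mul,
      mul_assoc, List.sum_map_mul_right]

/-- The recursive description of the annihilation part agrees with the sum over positions which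
defines `rho`. -/
theorem annih_comp_map (κ T : List A → D) (x : Letter → A) (w : List (D × Letter)) :
    ∀ p : List (D × Letter),
      annih (fun v => κ (v.map (evLetter x))) (fun v => T (v.map (evLetter x))) p w =
        T [] * κ (p.map (evLetter x) ++ w.map (evLetter x)) +
        ((List.finRange (w.map (evLetter x)).length).map
          fun i : Fin (w.map (evLetter x)).length =>
            T ((κ (p.map (evLetter x) ++ (w.map (evLetter x)).take i) : A) *
              (w.map (evLetter x)).get i :: (w.map (evLetter x)).drop ((i : ℕ) + 1))).sum := by
  induction w with
  | nil => intro p; simp [annih, act]; rfl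
  | cons b w ih =>
    intro p
    rw [annih, ih]
    have e (d : D) : evLetter x (d * b.1, b.2) = (d : A) * evLetter x b := by
      simp [evLetter, mul_assoc]
    have hfin (l : List A) (a : A) (f : Fin (a :: l).length → D) :
        ((List.finRange (a :: l).length).map f).sum =
          f ⟨0, by simp⟩ + ((List.finRange l.length).map fun i => f i.succ).sum := by
      change ((List.finRange (l.length + 1)).map f).sum = _
      rw [List.finRange_succ, List.map_cons, List.sum_cons, List.map_map]
      rfl
    rw [List.map_cons, hfin]
    simp only [act, List.map_cons, e, List.map_append, List.map_nil, List.append_assoc,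
      List.cons_append, List.nil_append, List.take_zero, List.append_nil, Fin.val_succ,
      List.take_succ_cons, List.drop_succ_cons, List.drop_zero]
    rw [add_left_comm]
    rfl

/-- `rhoDual` is the transpose of `rho`: a functional may be paired with `ρ(c₁) ⋯ ρ(cₙ) Ω` by
letting the operators act on the functional from the right. -/
theorem pairing_fockVector (κ : List A → D) (x : Letter → A) (w : List (D × Letter)) :
    ∀ T : List A → D,
      pairing T (fockVector κ (w.map (evLetter x))) =
        w.foldl (rhoDual fun v => κ (v.map (evLetter x)))
          (fun v => T (v.map (evLetter x))) [] := by
  induction w with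
  | nil => intro T; simp [fockVector, pairing]
  | cons c w ih =>
    intro T
    rw [List.map_cons, fockVector, pairing_flatMap_rho, ih, List.foldl_cons]
    refine congrArg (fun T' => w.foldl (rhoDual fun v => κ (v.map (evLetter x))) T' [])
      (funext fun v => ?_)
    rw [rhoDual, annih_comp_map]
    rfl

theorem fockMoment_map (κ : List A → D) (x : Letter → A) {κ' : List (D × Letter) → D}
    (h : SlotAdd κ') (hl : LeftLin κ') (hκ : ∀ v, κ' v = κ (v.map (evLetter x)))
    (w : List (D × Letter)) :
    fockMoment κ (w.map (evLetter x)) = (fockSpace κ' h).moment w := by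
  obtain rfl : κ' = fun v => κ (v.map (evLetter x)) := funext hκ
  rw [fockSpace_moment h hl]
  have h1 : fockMoment κ (w.map (evLetter x)) =
      pairing (fun v => if v.length = 0 then 1 else 0) (fockVector κ (w.map (evLetter x))) := by
    simp [fockMoment, vacuum, pairing]
  rw [h1, pairing_fockVector]
  refine congrArg (fun T' => w.foldl (rhoDual fun v => κ (v.map (evLetter x))) T' [])
    (funext fun v => ?_)
  cases v <;> simp [vac]

end FockMoment

/-- The cumulants of words of fewer than `n` letters, and `0` in place of the others. -/
def cumulantBelow (x : Letter → A) (n : ℕ) (w : List (D × Letter)) : D :=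
  if w.length < n then cumulant E (w.map (evLetter x)) else 0

theorem TwoLetterSpace.slotAdd_moment {D B : Type*} [Ring D] [Ring B] (M : TwoLetterSpace D B) :
    SlotAdd M.moment := by
  intro v d d' s w
  simp [TwoLetterSpace.moment, add_mul, mul_add]

/-- The moment-cumulant formula, solved for the cumulant of highest order. -/
theorem cumulant_eq_moment_sub (x : Letter → A) (w : List (D × Letter))
    (h : SlotAdd (cumulantBelow E x w.length)) (hl : LeftLin (cumulantBelow E x w.length)) :
    cumulant E (w.map (evLetter x)) =
      (E.marked x).moment w - (fockSpace _ h).moment w := by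
  rw [cumulant, ← fockMoment_map (fun m : List A =>
    if _h : m.length < (w.map (evLetter x)).length then cumulant E m else 0) x h hl
    (fun v => by simp [cumulantBelow])]
  rfl

/-- The cumulants are additive in each argument and left `D`-linear in the first one: these
properties pass from the moments and the cumulants of lower order to the next cumulant. -/
theorem cumulantBelow_props (x : Letter → A) (n : ℕ) :
    SlotAdd (cumulantBelow E x n) ∧ LeftLin (cumulantBelow E x n) := by
  induction n with
  | zero => exact ⟨fun v d d' s w => by simp [cumulantBelow], fun d w _ => by simp [cumulantBelow]⟩
  | succ n ih =>
    have key (w : List (D × Letter)) (hn : w.length = n) : cumulantBelow E x (n + 1) w =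
        (E.marked x).moment w - (fockSpace _ ih.1).moment w := by
      subst hn
      rw [cumulantBelow, if_pos (Nat.lt_succ_self _)]
      exact cumulant_eq_moment_sub E x w ih.1 ih.2
    have key' (w : List (D × Letter)) (hn : w.length ≠ n) :
        cumulantBelow E x (n + 1) w = cumulantBelow E x n w := by
      simp only [cumulantBelow]
      congr 1
      simp only [eq_iff_iff]; omega
    constructor
    · intro v d d' s w
      by_cases hn : (v ++ (d, s) :: w).length = n
      · rw [key _ (by simpa using hn), key _ hn, key _ (by simpa using hn),
          (E.marked x).slotAdd_moment, (fockSpace _ ih.1).slotAdd_moment]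
        abel
      · rw [key' _ (by simpa using hn), key' _ hn, key' _ (by simpa using hn), ih.1]
    · intro d w hw
      by_cases hn : w.length = n
      · rw [key _ (by simpa using hn), key _ hn, TwoLetterSpace.moment_scale _ _ hw,
          TwoLetterSpace.moment_scale _ _ hw, mul_sub]
      · rw [key' _ (by simpa using hn), key' _ hn, ih.2 d w hw]

/-- The truncated cumulants reproduce the moments of short words. -/
theorem fockSpace_cumulantBelow_moment (x : Letter → A) {n : ℕ} {w : List (D × Letter)}
    (hn : w.length < n) :
    (fockSpace _ (cumulantBelow_props E x n).1).moment w = (E.marked x).moment w := by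
  obtain ⟨h, hl⟩ := cumulantBelow_props E x n
  obtain rfl | hw := eq_or_ne w []
  · simp [TwoLetterSpace.moment, TwoLetterSpace.exp_one]
  rw [← fockMoment_map (fun m : List A => if m.length < n then cumulant E m else 0) x h hl
    (fun v => by simp [cumulantBelow]), E.marked_moment,
    ← fockMoment_cumulant E (by simpa using hw), fockMoment, fockMoment]
  congr 1
  refine fockVector_congr fun m _ hm => ?_
  rw [if_pos (by simp only [List.length_map] at hm; omega)]

/-- If only alternating cumulants occur, then `E` is the vacuum expectation of a Fock space to which
`fockSpace_isDiag` applies.  Conversely, a nonalternating cumulant is the difference of a moment of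
`a` and a moment built from cumulants of lower order, and these agree, because
`IsDiag.moment_eq` computes both from the same moments of shorter words. -/
theorem cumulantCondition_iff_isDiag (a : A) :
    CumulantCondition E a ↔ (E.marked (letterPow a)).IsDiag := by
  have hcond : CumulantCondition E a ↔
      ∀ n, AltSupported (cumulantBelow E (letterPow a) n) := by
    constructor
    · intro h n w hw hne
      by_contra hcon
      rw [← isAlternating_iff] at hcon
      have h0 : cumulant E (w.map (evLetter (letterPow a))) = 0 := h w hw hcon
      exact hne (by rw [cumulantBelow, h0, ite_self])
    · intro h w hw hcon
      rw [isAlternating_iff] at hcon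
      by_contra hne
      refine hcon (h (w.length + 1) w hw ?_)
      rw [cumulantBelow, if_pos (Nat.lt_succ_self _)]
      exact hne
  rw [hcond]
  constructor
  · intro h
    -- every moment condition involves only finitely many cumulants
    have hD n := fockSpace_isDiag (cumulantBelow_props E (letterPow a) n).1
      (cumulantBelow_props E (letterPow a) n).2 (h n)
    refine ⟨fun i y hy => ?_, fun i k Y hY hch => ?_⟩
    · rw [← fockSpace_cumulantBelow_moment E _ (Nat.lt_succ_self y.length)]
      exact (hD _).odd i y hy
    · have hm (w : List (D × Letter)) (hw : w.length ≤ Y.flatten.length) :=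
        fockSpace_cumulantBelow_moment E (letterPow a) (Nat.lt_succ_of_le hw)
      have key := TwoLetterSpace.exp_prod_centred_sub (n := Y.flatten.length)
        (fun w hw => hm w hw.le) Y (fun y hy => ⟨(hch.alt_of_mem hy).1, hm y ?_⟩) [] 1 (by simp)
      · have h' := hm Y.flatten le_rfl
        simp only [TwoLetterSpace.moment] at h'
        simp only [TwoLetterSpace.ev_nil, map_one, one_mul, h', sub_self,
          (hD _).chain i k Y hY hch, zero_sub, neg_eq_zero] at key
        exact key
      · obtain ⟨s, t, rfl⟩ := List.append_of_mem hy
        simp only [List.flatten_append, List.flatten_cons, List.length_append]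
        omega
  · intro h n
    induction n with
    | zero => intro w _ hne; simp [cumulantBelow] at hne
    | succ n ih =>
      intro w hw hne
      by_cases hn : w.length = n
      · -- the moment of `w` is computed from shorter words in the same way for `a` and for the
        -- operators built from the cumulants of lower order
        by_contra hcon
        subst hn
        obtain ⟨h1, h2⟩ := cumulantBelow_props E (letterPow a) w.length
        rw [cumulantBelow, if_pos (Nat.lt_succ_self _), cumulant_eq_moment_sub E _ w h1 h2] at hne
        refine hne (sub_eq_zero.2 (h.moment_eq (fockSpace_isDiag h1 h2 ih) (fun v hv => ?_) w rfl
          fun i hi => absurd ⟨i, hi⟩ hcon))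
        exact (fockSpace_cumulantBelow_moment E _ hv).symm
      · refine ih w hw ?_
        have : w.length < n + 1 := by
          by_contra hlt; exact hne (by rw [cumulantBelow, if_neg hlt])
        rw [cumulantBelow, if_pos this] at hne
        rwa [cumulantBelow, if_pos (by omega)]

end Element

/-! ### The moment condition in terms of words -/

section MomentWords

variable {A : Type u} [Ring A] [StarRing A] [Algebra ℂ A] [StarModule ℂ A]
variable {D : StarSubalgebra ℂ A} (E : CondExp D) (a : A)

/-- The index of the spaces `P` that corresponds to an exponent: the elements of `P i j` start
with the exponent of index `i`, and end with the exponent of index `j`. -/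
def Letter.index : Letter → Fin 2
  | .star => 0
  | .one => 1

/-- The exponent of a given index. -/
def letterOf : Fin 2 → Letter := ![.star, .one]

@[simp] theorem index_letterOf (i : Fin 2) : (letterOf i).index = i := by fin_cases i <;> rfl

/-- The subalgebra `D`, as a linear subspace. -/
abbrev coeffSpace (D : StarSubalgebra ℂ A) : Submodule ℂ A :=
  Subalgebra.toSubmodule D.toSubalgebra

/-- The span of `d₀ a^{s₁} d₁ ⋯ a^{sₙ} dₙ` over all alternating `s₁, …, sₙ` which start with `s`
and would be continued by `k`. -/
def wordSpace (s k : Letter) : Submodule ℂ A :=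
  Submodule.span ℂ {z | ∃ (w : List (D × Letter)) (d : D), Alt s w k ∧
    z = (E.marked (letterPow a)).ev w * (d : A)}

/-- The span of the alternating products of even length which start with `s`. -/
def evenSpace (D : StarSubalgebra ℂ A) (s : Letter) (k : ℕ) : Submodule ℂ A :=
  (coeffSpace D * Submodule.span ℂ {letterPow a s} * coeffSpace D *
    Submodule.span ℂ {letterPow a s.flip}) ^ k * coeffSpace D

/-- The span of the alternating products of odd length which start with `s`. -/
def oddSpace (D : StarSubalgebra ℂ A) (s : Letter) (k : ℕ) : Submodule ℂ A :=
  coeffSpace D * Submodule.span ℂ {letterPow a s} *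
    (coeffSpace D * Submodule.span ℂ {letterPow a s.flip} * coeffSpace D *
      Submodule.span ℂ {letterPow a s}) ^ k * coeffSpace D

theorem evenSpace_succ (s : Letter) (k : ℕ) : evenSpace a D s (k + 1) =
    coeffSpace D * (Submodule.span ℂ {letterPow a s} * oddSpace a D s.flip k) := by
  simp only [evenSpace, oddSpace, pow_succ', mul_assoc, Letter.flip_flip]

theorem oddSpace_eq (s : Letter) (k : ℕ) : oddSpace a D s k =
    coeffSpace D * (Submodule.span ℂ {letterPow a s} * evenSpace a D s.flip k) := by
  simp only [evenSpace, oddSpace, mul_assoc, Letter.flip_flip]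

theorem mul_wordSpace_le (s k : Letter) :
    coeffSpace D * (Submodule.span ℂ {letterPow a s} * wordSpace E a s.flip k) ≤
      wordSpace E a s k := by
  rw [wordSpace, Submodule.span_mul_span, ← Submodule.span_eq (coeffSpace D),
    Submodule.span_mul_span, Submodule.span_le]
  rintro _ ⟨d, hd, _, ⟨_, rfl, _, ⟨w, e, hw, rfl⟩, rfl⟩, rfl⟩
  exact Submodule.subset_span ⟨(⟨d, hd⟩, s) :: w, e, ⟨rfl, hw⟩, by simp [mul_assoc]⟩

theorem evenSpace_le_and_oddSpace_le (k : ℕ) : ∀ s : Letter,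
    evenSpace a D s k ≤ wordSpace E a s s ∧ oddSpace a D s k ≤ wordSpace E a s s.flip := by
  have step (k : ℕ) (h : ∀ s : Letter, evenSpace a D s k ≤ wordSpace E a s s) (s : Letter) :
      oddSpace a D s k ≤ wordSpace E a s s.flip := by
    rw [oddSpace_eq]
    refine le_trans ?_ (mul_wordSpace_le E a s s.flip)
    gcongr
    exact h s.flip
  induction k with
  | zero =>
    have h0 : ∀ s : Letter, evenSpace a D s 0 ≤ wordSpace E a s s := by
      intro s d hd
      rw [evenSpace, pow_zero, one_mul] at hd
      exact Submodule.subset_span ⟨[], ⟨d, hd⟩, rfl, by simp⟩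
    exact fun s => ⟨h0 s, step 0 h0 s⟩
  | succ k ih =>
    have h1 : ∀ s : Letter, evenSpace a D s (k + 1) ≤ wordSpace E a s s := by
      intro s
      rw [evenSpace_succ]
      refine le_trans ?_ (mul_wordSpace_le E a s s)
      gcongr
      simpa using (ih s.flip).2
    exact fun s => ⟨h1 s, step _ h1 s⟩

theorem ev_mul_mem (w : List (D × Letter)) (d : D) : ∀ s : Letter,
    (Alt s w s → ∃ k, (E.marked (letterPow a)).ev w * (d : A) ∈ evenSpace a D s k) ∧
    (Alt s w s.flip → ∃ k, (E.marked (letterPow a)).ev w * (d : A) ∈ oddSpace a D s k) := by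
  induction w with
  | nil => exact fun s => ⟨fun _ => ⟨0, by simp [evenSpace]⟩, fun h => absurd h s.ne_flip⟩
  | cons c w ih =>
    intro s
    have hmem : ∀ {V : Submodule ℂ A}, (E.marked (letterPow a)).ev w * (d : A) ∈ V → c.2 = s →
        (E.marked (letterPow a)).ev (c :: w) * (d : A) ∈
          coeffSpace D * (Submodule.span ℂ {letterPow a s} * V) := by
      rintro V hV rfl
      rw [TwoLetterSpace.ev_cons, mul_assoc, mul_assoc]
      exact Submodule.mul_mem_mul c.1.2
        (Submodule.mul_mem_mul (Submodule.mem_span_singleton_self _) hV)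
    refine ⟨fun h => ?_, fun h => ?_⟩
    · obtain ⟨k, hk⟩ := (ih s.flip).2 (by simpa using h.2)
      exact ⟨k + 1, by rw [evenSpace_succ]; exact hmem hk h.1⟩
    · obtain ⟨k, hk⟩ := (ih s.flip).1 h.2
      exact ⟨k, by rw [oddSpace_eq]; exact hmem hk h.1⟩

theorem iSup_evenSpace (s : Letter) : ⨆ k, evenSpace a D s k = wordSpace E a s s := by
  refine le_antisymm (iSup_le fun k => (evenSpace_le_and_oddSpace_le E a k s).1) ?_
  rw [wordSpace, Submodule.span_le]
  rintro _ ⟨w, d, hw, rfl⟩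
  obtain ⟨k, hk⟩ := (ev_mul_mem E a w d s).1 hw
  exact Submodule.mem_iSup_of_mem k hk

theorem iSup_oddSpace (s : Letter) : ⨆ k, oddSpace a D s k = wordSpace E a s s.flip := by
  refine le_antisymm (iSup_le fun k => (evenSpace_le_and_oddSpace_le E a k s).2) ?_
  rw [wordSpace, Submodule.span_le]
  rintro _ ⟨w, d, hw, rfl⟩
  obtain ⟨k, hk⟩ := (ev_mul_mem E a w d s).2 hw
  exact Submodule.mem_iSup_of_mem k hk

theorem P_index_self (s : Letter) : P E a s.index s.index = wordSpace E a s s.flip := by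
  rw [← iSup_oddSpace]
  cases s <;> rfl

theorem P_index_flip (s : Letter) : P E a s.index s.flip.index =
    wordSpace E a s s ⊓ LinearMap.ker E.toLinearMap := by
  rw [← iSup_evenSpace]
  cases s <;> rfl

/-- Sequences of elements of the spaces `P` with matching indices. -/
def MomentChain : Letter → List A → Letter → Prop
  | s, [], t => s = t
  | s, x :: X, t => ∃ m : Letter, x ∈ P E a s.index m.index ∧ MomentChain m X t

theorem momentCondition_iff_momentChain : MomentCondition E a ↔
    ∀ s X t, X ≠ [] → MomentChain E a s X t → E X.prod = 0 := by
  constructor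
  · intro h s X t hX hch
    have key : ∀ (X : List A) (s : Letter), MomentChain E a s X t →
        ∃ i : Fin (X.length + 1) → Fin 2, i 0 = s.index ∧
          ∀ k : Fin X.length, X.get k ∈ P E a (i k.castSucc) (i k.succ) := by
      intro X
      induction X with
      | nil => exact fun s _ => ⟨fun _ => s.index, rfl, fun k => k.elim0⟩
      | cons x X ih =>
        rintro s ⟨m, hx, hX⟩
        obtain ⟨i, hi0, hi⟩ := ih m hX
        refine ⟨Fin.cons s.index i, rfl, fun k => ?_⟩
        refine Fin.cases ?_ (fun k => ?_) k
        · simpa [hi0] using hx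
        · exact hi k
    obtain ⟨i, -, hi⟩ := key X s hch
    have := h X.length (List.length_pos_iff.2 hX) i X.get hi
    rwa [List.ofFn_get] at this
  · intro h n hn i x hx
    have key : ∀ (n : ℕ) (i : Fin (n + 1) → Fin 2) (x : Fin n → A),
        (∀ k, x k ∈ P E a (i k.castSucc) (i k.succ)) →
        MomentChain E a (letterOf (i 0)) (List.ofFn x) (letterOf (i (Fin.last n))) := by
      intro n
      induction n with
      | zero => intro i x _; rfl
      | succ n ih =>
        intro i x hx
        rw [List.ofFn_succ]
        refine ⟨letterOf (i 1), ?_, ih (fun k => i k.succ) (fun k => x k.succ) fun k => ?_⟩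
        · simpa using hx 0
        · exact hx k.succ
    refine h _ _ _ ?_ (key n i x hx)
    rw [Ne, List.ofFn_eq_nil_iff]
    omega

/-- The elements of the spaces `P` are sums of centred alternating words. -/
theorem mem_span_centred_of_mem_P (hodd : ∀ (i : Letter) (y : List (D × Letter)),
      Alt i y i.flip → (E.marked (letterPow a)).moment y = 0)
    {s m : Letter} {x : A} (hx : x ∈ P E a s.index m.index) :
    x ∈ Submodule.span ℂ {z | ∃ (y : List (D × Letter)) (d : D), y ≠ [] ∧ Alt s y m.flip ∧
      z = (E.marked (letterPow a)).centred y * (d : A)} := by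
  by_cases hsm : m = s
  · subst hsm
    rw [P_index_self] at hx
    refine (Submodule.span_le.2 ?_) hx
    rintro _ ⟨w, d, hw, rfl⟩
    refine Submodule.subset_span ⟨w, d, ?_, hw, by
      rw [TwoLetterSpace.centred, hodd _ _ hw, map_zero, sub_zero]⟩
    rintro rfl
    exact m.ne_flip hw
  · obtain rfl := Letter.eq_flip_of_ne hsm
    rw [P_index_flip] at hx
    obtain ⟨hx, hx0⟩ := hx
    rw [SetLike.mem_coe, LinearMap.mem_ker] at hx0
    let L : A →ₗ[ℂ] A := LinearMap.id - (coeffSpace D).subtype ∘ₗ E.toLinearMap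
    have hL (z : A) : L z = z - (E z : A) := rfl
    have hLx : L x = x := by rw [hL, hx0]; simp
    rw [← hLx, ← Submodule.mem_comap]
    refine (Submodule.span_le.2 ?_) hx
    rintro _ ⟨w, d, hw, rfl⟩
    have e : L ((E.marked (letterPow a)).ev w * (d : A)) =
        (E.marked (letterPow a)).centred w * (d : A) := by
      rw [hL, E.map_mul_right, TwoLetterSpace.centred, sub_mul]; rfl
    rw [SetLike.mem_coe, Submodule.mem_comap, e]
    obtain rfl | hw0 := eq_or_ne w []
    · convert Submodule.zero_mem _
      simp [TwoLetterSpace.centred, TwoLetterSpace.moment, E.map_one]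
    · exact Submodule.subset_span ⟨w, d, hw0, by simpa using hw, rfl⟩

/-- The moment condition need only be tested on centred words, since these span the spaces `P` as
right `D`-modules, and the coefficients from `D` can be absorbed into the next word. -/
theorem momentCondition_iff_isDiag :
    MomentCondition E a ↔ (E.marked (letterPow a)).IsDiag := by
  rw [momentCondition_iff_momentChain]
  constructor
  · intro h
    have hodd : ∀ (i : Letter) (y : List (D × Letter)), Alt i y i.flip →
        (E.marked (letterPow a)).moment y = 0 := by
      intro i y hy
      have hmem : (E.marked (letterPow a)).ev y ∈ P E a i.index i.index := by
        rw [P_index_self]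
        exact Submodule.subset_span ⟨y, 1, hy, by simp⟩
      have := h i [_] i (by simp) ⟨i, hmem, rfl⟩
      rwa [List.prod_singleton] at this
    refine ⟨hodd, fun i k Y hY hch => h i _ k (by simpa using hY) ?_⟩
    clear hY
    induction Y generalizing i with
    | nil => exact hch
    | cons y Y ih =>
      obtain ⟨-, m, hy, hch⟩ := hch
      refine ⟨m, ?_, ih m hch⟩
      by_cases him : m = i
      · subst him
        rw [TwoLetterSpace.centred, hodd _ _ hy, map_zero, sub_zero, P_index_self]
        exact Submodule.subset_span ⟨y, 1, hy, by simp⟩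
      · obtain rfl := Letter.eq_flip_of_ne him
        rw [P_index_flip]
        refine ⟨sub_mem (Submodule.subset_span ⟨y, 1, by simpa using hy, by simp⟩)
          (Submodule.subset_span ⟨[], _, rfl, (one_mul _).symm⟩), ?_⟩
        exact (E.marked (letterPow a)).exp_centred y
  · intro h s X t hX hch
    have key : ∀ (X : List A) (m : Letter) (i : Letter) (Y : List (List (D × Letter))) (d : D),
        AltChain i Y m → MomentChain E a m X t → (X = [] → Y ≠ []) →
        E ((Y.map (E.marked (letterPow a)).centred).prod * (d : A) * X.prod) = 0 := by
      intro X
      induction X with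
      | nil =>
        intro m i Y d hY _ hne
        rw [List.prod_nil, mul_one, E.map_mul_right]
        have := h.chain i m Y (hne rfl) hY
        rw [E.marked_exp] at this
        rw [this, zero_mul]
      | cons x X ih =>
        rintro m i Y d hY ⟨m', hx, hX⟩ -
        have hx' := mem_span_centred_of_mem_P E a h.odd hx
        clear hx
        induction hx' using Submodule.span_induction with
        | mem z hz =>
          obtain ⟨y, e, hy0, hy, rfl⟩ := hz
          have := ih m' i (Y ++ [scale d y]) e
            (altChain_append.2 ⟨m, hY, by simpa using hy0, m', by simpa using hy, rfl⟩) hX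
            (by simp)
          rw [List.map_append, List.prod_append, List.map_singleton, List.prod_singleton,
            TwoLetterSpace.centred_scale _ _ hy0] at this
          simpa [mul_assoc] using this
        | zero => simp
        | add y z _ _ hy hz =>
          rw [List.prod_cons] at hy hz ⊢
          rw [add_mul, mul_add, map_add, hy, hz, add_zero]
        | smul c z _ hz =>
          rw [List.prod_cons] at hz ⊢
          rw [smul_mul_assoc, mul_smul_comm, map_smul, hz, smul_zero]
    have := key X s s [] 1 rfl hch (fun h => absurd h hX)
    simpa using this

end MomentWords

/-! ### Multiplication by a free scalar unitary -/

section Freeness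

variable {A : Type u} [Ring A] [StarRing A] [Algebra ℂ A] [StarModule ℂ A]
variable {D : StarSubalgebra ℂ A} (E : CondExp D) (X : Fin 2 → Set A)

/-- The algebra generated by `X i` and `D`. -/
def legAlgebra (D : StarSubalgebra ℂ A) (X : Fin 2 → Set A) (i : Fin 2) : Subalgebra ℂ A :=
  Algebra.adjoin ℂ (X i ∪ (D : Set A))

/-- Products of centred elements of alternating algebras, the last one from the `i`-th algebra. -/
inductive FreeProduct : Fin 2 → A → Prop
  | single {i : Fin 2} {x : A} : x ∈ legAlgebra D X i → E x = 0 → FreeProduct i x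
  | snoc {i j : Fin 2} {z x : A} : FreeProduct i z → i ≠ j → x ∈ legAlgebra D X j → E x = 0 →
      FreeProduct j (z * x)

variable {E X}

theorem FreeOver.apply_eq_zero (h : FreeOver E X) {i : Fin 2} {z : A}
    (hz : FreeProduct E X i z) : E z = 0 := by
  obtain ⟨L, y, hch, hmem, rfl⟩ : ∃ (L : List (Fin 2 × A)) (y : A),
      (L ++ [(i, y)]).IsChain (fun p q => p.1 ≠ q.1) ∧
      (∀ p ∈ L ++ [(i, y)], p.2 ∈ legAlgebra D X p.1 ∧ E p.2 = 0) ∧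
      ((L ++ [(i, y)]).map Prod.snd).prod = z := by
    induction hz with
    | single hx h0 => exact ⟨[], _, by simp, by simpa using ⟨hx, h0⟩, by simp⟩
    | @snoc i j z x _ hij hx h0 ih =>
      obtain ⟨L, y, hch, hmem, rfl⟩ := ih
      refine ⟨L ++ [(i, y)], x, ?_, ?_, by simp [mul_assoc]⟩
      · rw [List.isChain_append]
        exact ⟨hch, by simp, by simpa using hij⟩
      · intro p hp
        rcases List.mem_append.1 hp with hp | hp
        · exact hmem p hp
        · obtain rfl := List.mem_singleton.1 hp
          exact ⟨hx, h0⟩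
  set M := L ++ [(i, y)] with hM
  have hMl : 1 ≤ M.length := by simp [hM]
  have := h M.length hMl (fun k => (M.get k).1) (fun k => (M.get k).2) ?_
    (fun k => (hmem _ (List.get_mem M k)).1) (fun k => (hmem _ (List.get_mem M k)).2)
  · rwa [← Function.comp_def Prod.snd M.get, ← List.map_ofFn, List.ofFn_get] at this
  · intro k l hkl
    have := List.isChain_iff_getElem.1 hch k (by omega)
    simpa [hkl] using this

theorem coe_mem_legAlgebra (d : D) (i : Fin 2) : (d : A) ∈ legAlgebra D X i :=
  Algebra.subset_adjoin (.inr d.2)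

variable (E X) in
/-- An element of the algebra of `X 1` and `D` whose expectation is the scalar `α`. -/
def HasScalarExp (g : A) (α : ℂ) : Prop := g ∈ legAlgebra D X 1 ∧ E g = algebraMap ℂ D α

theorem HasScalarExp.sub_algebraMap {g : A} {α : ℂ} (hg : HasScalarExp E X g α) :
    g - algebraMap ℂ A α ∈ legAlgebra D X 1 ∧ E (g - algebraMap ℂ A α) = 0 :=
  ⟨sub_mem hg.1 (Subalgebra.algebraMap_mem _ _), by
    have : E (algebraMap ℂ A α) = algebraMap ℂ D α := E.map_coe (algebraMap ℂ D α)
    rw [map_sub, hg.2, this, sub_self]⟩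

theorem HasScalarExp.mul_mul_eq {g : A} {α : ℂ} (x y : A) :
    E (x * g * y) = E (x * (g - algebraMap ℂ A α) * y) + α • E (x * y) := by
  rw [mul_sub, sub_mul, map_sub, ← Algebra.commutes, mul_assoc (algebraMap ℂ A α),
    ← Algebra.smul_def, map_smul, sub_add_cancel]

/-- The product `g₁ z₁ g₂ z₂ ⋯` for `R = [((g₁, α₁), z₁), ((g₂, α₂), z₂), …]`. -/
def gapProd (R : List ((A × ℂ) × A)) : A := (R.map fun r => r.1.1 * r.2).prod

@[simp] theorem gapProd_nil : gapProd ([] : List ((A × ℂ) × A)) = 1 := rfl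

@[simp] theorem gapProd_cons (r : (A × ℂ) × A) (R : List ((A × ℂ) × A)) :
    gapProd (r :: R) = r.1.1 * r.2 * gapProd R := by simp [gapProd]

variable (E) in
/-- All products of neighbouring elements of `b, z₁, z₂, …` are centred. -/
def AllCentred : A → List A → Prop
  | b, [] => E b = 0
  | b, z :: Z => E b = 0 ∧ AllCentred z Z ∧ AllCentred (b * z) Z

variable (E) in
/-- All products of neighbouring elements of `b, z₁, z₂, …`, except possibly the product of all of
them, are centred. -/
def ProperCentred : A → List A → Prop
  | _, [] => True
  | b, z :: Z => E b = 0 ∧ AllCentred E z Z ∧ ProperCentred (b * z) Z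

/-- The elements `gᵢ` which separate the factors are centred one after the other; where a factor
`gᵢ` is replaced with its expectation, its neighbours merge into one centred factor. -/
theorem FreeOver.apply_gapProd (h : FreeOver E X) {post : A} {β : ℂ}
    (hpost : HasScalarExp E X post β) (R : List ((A × ℂ) × A))
    (hR : ∀ r ∈ R, HasScalarExp E X r.1.1 r.1.2 ∧ r.2 ∈ legAlgebra D X 0) :
    ∀ x b : A, (x = 1 ∨ FreeProduct E X 1 x) → b ∈ legAlgebra D X 0 →
      AllCentred E b (R.map Prod.snd) → E (x * b * gapProd R * post) = 0 := by
  have step {x b : A} (hx : x = 1 ∨ FreeProduct E X 1 x) (hb : b ∈ legAlgebra D X 0)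
      (h0 : E b = 0) : FreeProduct E X 0 (x * b) := by
    rcases hx with rfl | hx
    · rw [one_mul]; exact .single hb h0
    · exact .snoc hx (by decide) hb h0
  induction R with
  | nil =>
    intro x b hx hb hc
    have hz := step hx hb hc
    rw [gapProd_nil, mul_one, ← mul_one (x * b * post),
      HasScalarExp.mul_mul_eq (α := β), mul_one, mul_one, h.apply_eq_zero hz, smul_zero, add_zero]
    exact h.apply_eq_zero (.snoc hz (by decide) hpost.sub_algebraMap.1 hpost.sub_algebraMap.2)
  | cons r R ih =>
    rintro x b hx hb ⟨h0, h1, h2⟩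
    have ih' := ih fun s hs => hR s (List.mem_cons_of_mem _ hs)
    obtain ⟨hg, hz⟩ := hR r (by simp)
    have e : x * b * gapProd (r :: R) * post = x * b * r.1.1 * (r.2 * gapProd R * post) := by
      simp [mul_assoc]
    rw [e, HasScalarExp.mul_mul_eq (α := r.1.2)]
    have t1 := ih' (x * b * (r.1.1 - algebraMap ℂ A r.1.2)) r.2
      (.inr (.snoc (step hx hb h0) (by decide) hg.sub_algebraMap.1 hg.sub_algebraMap.2)) hz h1
    have t2 := ih' x (b * r.2) hx (mul_mem hb hz) h2
    simp only [mul_assoc] at t1 t2 ⊢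
    rw [t1, t2, smul_zero, add_zero]

theorem FreeOver.apply_mul_gapProd (h : FreeOver E X) {pre post : A} {α β : ℂ}
    (hpre : HasScalarExp E X pre α) (hpost : HasScalarExp E X post β) (R : List ((A × ℂ) × A))
    (hR : ∀ r ∈ R, HasScalarExp E X r.1.1 r.1.2 ∧ r.2 ∈ legAlgebra D X 0) {b : A}
    (hb : b ∈ legAlgebra D X 0) (hc : AllCentred E b (R.map Prod.snd)) :
    E (pre * b * gapProd R * post) = 0 := by
  have e : pre * b * gapProd R * post = 1 * pre * (b * gapProd R * post) := by
    simp [mul_assoc]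
  rw [e, HasScalarExp.mul_mul_eq (α := α)]
  have t1 := h.apply_gapProd hpost R hR (pre - algebraMap ℂ A α) b
    (.inr (.single hpre.sub_algebraMap.1 hpre.sub_algebraMap.2)) hb hc
  have t2 := h.apply_gapProd hpost R hR 1 b (.inl rfl) hb hc
  simp only [mul_assoc, one_mul] at t1 t2 ⊢
  rw [t1, t2, smul_zero, add_zero]

/-- A version of `FreeOver.apply_mul_gapProd` for factors whose total product is not known to be
centred: only the term in which all separating elements are replaced with their expectations
survives. -/
theorem FreeOver.apply_mul_gapProd_of_proper (h : FreeOver E X) {pre post : A} {α β : ℂ}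
    (hpre : HasScalarExp E X pre α) (hpost : HasScalarExp E X post β) (R : List ((A × ℂ) × A))
    (hR : ∀ r ∈ R, HasScalarExp E X r.1.1 r.1.2 ∧ r.2 ∈ legAlgebra D X 0) :
    ∀ b ∈ legAlgebra D X 0, ProperCentred E b (R.map Prod.snd) →
      E (pre * b * gapProd R * post) =
        (R.map fun r => r.1.2).prod • E (pre * (b * (R.map Prod.snd).prod) * post) := by
  induction R with
  | nil => intro b _ _; simp
  | cons r R ih =>
    rintro b hb ⟨h0, h1, h2⟩
    have hR' := fun s hs => hR s (List.mem_cons_of_mem _ hs)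
    obtain ⟨hg, hz⟩ := hR r (by simp)
    have e : pre * b * gapProd (r :: R) * post = pre * b * r.1.1 * (r.2 * gapProd R * post) := by
      simp [mul_assoc]
    have t1 : E (pre * b * (r.1.1 - algebraMap ℂ A r.1.2) * (r.2 * gapProd R * post)) = 0 := by
      have e' : pre * b * (r.1.1 - algebraMap ℂ A r.1.2) * (r.2 * gapProd R * post) =
          1 * pre * (b * (r.1.1 - algebraMap ℂ A r.1.2) * (r.2 * gapProd R * post)) := by
        simp [mul_assoc]
      have hb0 := FreeProduct.single (E := E) (X := X) hb h0
      have s1 := h.apply_gapProd hpost R hR'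
        ((pre - algebraMap ℂ A α) * b * (r.1.1 - algebraMap ℂ A r.1.2)) r.2
        (.inr (.snoc (.snoc (.single hpre.sub_algebraMap.1 hpre.sub_algebraMap.2) (by decide) hb h0)
          (by decide) hg.sub_algebraMap.1 hg.sub_algebraMap.2)) hz h1
      have s2 := h.apply_gapProd hpost R hR' (b * (r.1.1 - algebraMap ℂ A r.1.2)) r.2
        (.inr (.snoc hb0 (by decide) hg.sub_algebraMap.1 hg.sub_algebraMap.2)) hz h1
      rw [e', HasScalarExp.mul_mul_eq (α := α)]
      simp only [mul_assoc, one_mul] at s1 s2 ⊢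
      rw [s1, s2, smul_zero, add_zero]
    rw [e, HasScalarExp.mul_mul_eq (α := r.1.2), t1, zero_add]
    have t2 := ih hR' (b * r.2) (mul_mem hb hz) h2
    simp only [List.map_cons, List.prod_cons, mul_smul]
    simp only [mul_assoc] at t2 ⊢
    rw [t2]

/-- Outer factors `pre` and `post` which are free from `b`, the first of which commutes with `D`,
multiply the expectation of `b` by the scalar `E(pre post)`. -/
theorem FreeOver.apply_mul_mul (h : FreeOver E X) {pre post : A} {α β γ : ℂ}
    (hpre : HasScalarExp E X pre α) (hpost : HasScalarExp E X post β)
    (hcomm : ∀ d : D, pre * (d : A) = d * pre) (hγ : E (pre * post) = algebraMap ℂ D γ)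
    {b : A} (hb : b ∈ legAlgebra D X 0) : E (pre * b * post) = γ • E b := by
  have h0 : E (b - (E b : A)) = 0 := by rw [map_sub, E.map_coe, sub_self]
  have h1 := h.apply_mul_gapProd hpre hpost [] (by simp)
    (sub_mem hb (coe_mem_legAlgebra (E b) 0)) h0
  rw [gapProd_nil, mul_one, mul_sub, sub_mul, map_sub, sub_eq_zero] at h1
  rw [h1, hcomm, mul_assoc, E.map_mul_left, hγ, ← Algebra.commutes, Algebra.smul_def]

end Freeness

section Unitary

variable {A : Type u} [Ring A] [StarRing A] [Algebra ℂ A] [StarModule ℂ A]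
variable {D : StarSubalgebra ℂ A} {E : CondExp D} {a u : A}

/-- The factor in front of `a^s` in `(u a)^s`. -/
def preFactor (u : A) : Letter → A
  | .one => u
  | .star => 1

/-- The factor behind `a^s` in `(u a)^s`. -/
def postFactor (u : A) : Letter → A
  | .one => 1
  | .star => star u

/-- The expectation of `preFactor u i * postFactor u k`, if `α` is that of `u`. -/
@[simp] def outerScalar (α : ℂ) : Letter → Letter → ℂ
  | .one, .one => α
  | .one, .star => 1
  | .star, .one => 1
  | .star, .star => star α

theorem letterPow_mul (u a : A) (s : Letter) :
    letterPow (u * a) s = preFactor u s * letterPow a s * postFactor u s := by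
  cases s <;> simp [letterPow, preFactor, postFactor]

theorem letterPow_mem_legAlgebra (s : Letter) :
    letterPow a s ∈ legAlgebra D ![{a, star a}, {u, star u}] 0 := by
  apply Algebra.subset_adjoin
  cases s <;> simp [letterPow]

theorem ev_mem_legAlgebra (y : List (D × Letter)) :
    (E.marked (letterPow a)).ev y ∈ legAlgebra D ![{a, star a}, {u, star u}] 0 := by
  induction y with
  | nil => exact one_mem _
  | cons c y ih =>
    rw [TwoLetterSpace.ev_cons]
    exact mul_mem (mul_mem (coe_mem_legAlgebra c.1 0) (letterPow_mem_legAlgebra c.2)) ih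

theorem centred_mem_legAlgebra (y : List (D × Letter)) :
    (E.marked (letterPow a)).centred y ∈ legAlgebra D ![{a, star a}, {u, star u}] 0 :=
  sub_mem (ev_mem_legAlgebra y) (coe_mem_legAlgebra _ 0)

namespace IsFreeScalarUnitary

variable (hu : IsFreeScalarUnitary E a u)
include hu

theorem pre_mul_coe (s : Letter) (d : D) : preFactor u s * (d : A) = d * preFactor u s := by
  cases s
  · exact (hu.1.2.1 d).1
  · simp [preFactor]

theorem post_mul_pre_flip (s : Letter) : postFactor u s * preFactor u s.flip = 1 := by
  cases s
  · simp [preFactor, postFactor, Letter.flip]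
  · exact hu.2.2.1

theorem pre_mul_post_flip (s : Letter) : preFactor u s * postFactor u s.flip = 1 := by
  cases s
  · exact hu.2.1
  · simp [preFactor, postFactor, Letter.flip]

theorem ev_mul {i k : Letter} {y : List (D × Letter)} (hy : Alt i y k) :
    (E.marked (letterPow (u * a))).ev y =
      preFactor u i * (E.marked (letterPow a)).ev y * postFactor u k.flip := by
  induction y generalizing i with
  | nil =>
    obtain rfl : i = k := hy
    simp [hu.pre_mul_post_flip]
  | cons c y ih =>
    obtain ⟨rfl, hy⟩ := hy
    simp only [TwoLetterSpace.ev_cons, CondExp.marked_emb, CondExp.marked_letter, letterPow_mul,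
      ih hy]
    have h1 := hu.pre_mul_coe c.2 c.1
    have h2 := hu.post_mul_pre_flip c.2
    calc (c.1 : A) * (preFactor u c.2 * letterPow a c.2 * postFactor u c.2) *
          (preFactor u c.2.flip * (E.marked (letterPow a)).ev y * postFactor u k.flip)
        = (c.1 * preFactor u c.2) * letterPow a c.2 *
            (postFactor u c.2 * preFactor u c.2.flip) *
            ((E.marked (letterPow a)).ev y * postFactor u k.flip) := by simp only [mul_assoc]
      _ = _ := by rw [h2, ← h1]; simp only [mul_assoc, mul_one]

theorem centred_mul {i k : Letter} {y : List (D × Letter)} (hy : Alt i y k)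
    (hm : (E.marked (letterPow (u * a))).moment y = (E.marked (letterPow a)).moment y)
    (hodd : k ≠ i → (E.marked (letterPow a)).moment y = 0) :
    (E.marked (letterPow (u * a))).centred y =
      preFactor u i * (E.marked (letterPow a)).centred y * postFactor u k.flip := by
  rw [TwoLetterSpace.centred, TwoLetterSpace.centred, hm, hu.ev_mul hy, mul_sub, sub_mul]
  congr 1
  by_cases hki : k = i
  · subst hki
    rw [CondExp.marked_emb, CondExp.marked_emb, hu.pre_mul_coe, mul_assoc,
      hu.pre_mul_post_flip, mul_one]
  · simp [hodd hki]

omit hu in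
/-- The product of the centred words of a chain, for `u a` in place of `a`: the words are
separated by the unitaries `u` and `u⋆`. -/
theorem exists_gapProd {α : Letter → ℂ} (k : Letter) (Y : List (List (D × Letter))) :
    ∀ (i : Letter) (y : List (D × Letter)), AltChain i (y :: Y) k →
      (∀ z ∈ y :: Y, ∀ j m, Alt j z m →
        (E.marked (letterPow (u * a))).centred z =
          preFactor u j * (E.marked (letterPow a)).centred z * postFactor u m.flip) →
      ∃ R : List ((A × ℂ) × A), R.map Prod.snd = Y.map (E.marked (letterPow a)).centred ∧
        (∀ r ∈ R, ∃ s, r.1 = (postFactor u s * preFactor u s, α s)) ∧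
        ((y :: Y).map (E.marked (letterPow (u * a))).centred).prod =
          preFactor u i * (E.marked (letterPow a)).centred y * gapProd R * postFactor u k := by
  induction Y with
  | nil =>
    rintro i y ⟨-, m, hy, rfl⟩ hc
    exact ⟨[], rfl, by simp, by simp [hc y (by simp) i _ hy]⟩
  | cons y₂ Y ih =>
    rintro i y ⟨-, m, hy, hch⟩ hc
    obtain ⟨R, h1, h2, h3⟩ := ih m y₂ hch fun z hz => hc z (List.mem_cons_of_mem _ hz)
    refine ⟨((postFactor u m * preFactor u m, α m), (E.marked (letterPow a)).centred y₂) :: R,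
      by simp [h1], ?_, ?_⟩
    · intro r hr
      rcases List.mem_cons.1 hr with rfl | hr
      · exact ⟨m, rfl⟩
      · exact h2 r hr
    · rw [List.map_cons, List.prod_cons, h3, hc y (by simp) i _ hy]
      simp [mul_assoc]

theorem exists_exp_eq : ∃ α : ℂ, E u = algebraMap ℂ D α := by
  obtain ⟨α, hα⟩ := hu.1.2.2 1 0
  exact ⟨α, by simpa using hα⟩

omit hu in
/-- The separating unitaries `u` and `u⋆` have conjugate scalar expectations. -/
theorem hasScalarExp_gap {α : ℂ} (hα : E u = algebraMap ℂ D α) (s : Letter) :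
    HasScalarExp E ![{a, star a}, {u, star u}] (postFactor u s * preFactor u s)
      (outerScalar α s s) := by
  cases s
  · refine ⟨?_, by simpa [preFactor, postFactor] using hα⟩
    simp only [preFactor, postFactor, one_mul]
    exact Algebra.subset_adjoin (by simp)
  · refine ⟨?_, ?_⟩
    · simp only [preFactor, postFactor, mul_one]
      exact Algebra.subset_adjoin (by simp)
    · simp only [preFactor, postFactor, mul_one]
      rw [E.map_star, hα, ← algebraMap_star_comm, outerScalar]

omit hu in
theorem hasScalarExp_pre {α : ℂ} (hα : E u = algebraMap ℂ D α) (s : Letter) :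
    HasScalarExp E ![{a, star a}, {u, star u}] (preFactor u s)
      (outerScalar α s .one) := by
  cases s
  · simpa [preFactor, postFactor] using hasScalarExp_gap hα .one
  · exact ⟨one_mem _, by simp [preFactor, E.map_one]⟩

omit hu in
theorem hasScalarExp_post {α : ℂ} (hα : E u = algebraMap ℂ D α) (s : Letter) :
    HasScalarExp E ![{a, star a}, {u, star u}] (postFactor u s)
      (outerScalar α .star s) := by
  cases s
  · exact ⟨one_mem _, by simp [postFactor, E.map_one]⟩
  · simpa [preFactor, postFactor] using hasScalarExp_gap hα .star

theorem exp_pre_mul_post {α : ℂ} (hα : E u = algebraMap ℂ D α) (i k : Letter) :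
    E (preFactor u i * postFactor u k) = algebraMap ℂ D (outerScalar α i k) := by
  cases i <;> cases k
  · simpa [preFactor, postFactor] using hα
  · simp [preFactor, postFactor, hu.2.1, E.map_one]
  · simp [preFactor, postFactor, E.map_one]
  · simpa [preFactor, postFactor] using (hasScalarExp_gap (a := a) hα .star).2

/-- Words which start with `i` and would be continued by `k` have proportional expectations for
`a` and for `u a`. -/
theorem moment_mul {α : ℂ} (hα : E u = algebraMap ℂ D α) {i k : Letter} {y : List (D × Letter)}
    (hy : Alt i y k.flip) :
    (E.marked (letterPow (u * a))).moment y =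
      outerScalar α i k • (E.marked (letterPow a)).moment y := by
  rw [TwoLetterSpace.moment, hu.ev_mul hy, Letter.flip_flip, CondExp.marked_exp,
    hu.2.2.2.apply_mul_mul (hasScalarExp_pre hα i) (hasScalarExp_post hα k)
      (hu.pre_mul_coe i) (hu.exp_pre_mul_post hα i k) (ev_mem_legAlgebra y)]
  rfl

omit hu in
/-- The chain condition for fewer than `n` words, in the form in which freeness uses it. -/
theorem allCentred_of_chain {n : ℕ} {M : TwoLetterSpace D A} (hM : ∀ x, M.exp x = E x)
    (hn : ∀ i k Y, Y ≠ [] → AltChain i Y k → Y.length < n → M.exp (Y.map M.centred).prod = 0)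
    {k : Letter} (Y : List (List (D × Letter))) :
    ∀ (X : List (List (D × Letter))) (i m : Letter), X ≠ [] → AltChain i X m → AltChain m Y k →
      X.length + Y.length < n → AllCentred E (X.map M.centred).prod (Y.map M.centred) := by
  induction Y with
  | nil =>
    intro X i m hX hXm _ hlen
    rw [List.map_nil, AllCentred, ← hM]
    exact hn i m X hX hXm (by simpa using hlen)
  | cons y Y ih =>
    intro X i m hX hXm hY hlen
    obtain ⟨hy0, m', hy, hY'⟩ := hY
    simp only [List.length_cons] at hlen
    refine ⟨?_, ?_, ?_⟩
    · rw [← hM]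
      exact hn i m X hX hXm (by omega)
    · have := ih [y] m m' (by simp) ⟨hy0, m', hy, rfl⟩ hY' (by simp; omega)
      simpa using this
    · have := ih (X ++ [y]) i m' (by simp) (altChain_append.2 ⟨m, hXm, hy0, m', hy, rfl⟩) hY'
        (by simp; omega)
      simpa using this

omit hu in
/-- The chain condition for fewer than `n` words says nothing about a product of `n` words, but it
covers all the proper subproducts. -/
theorem properCentred_of_chain {n : ℕ} {M : TwoLetterSpace D A} (hM : ∀ x, M.exp x = E x)
    (hn : ∀ i k Y, Y ≠ [] → AltChain i Y k → Y.length < n → M.exp (Y.map M.centred).prod = 0)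
    {k : Letter} (Y : List (List (D × Letter))) :
    ∀ (X : List (List (D × Letter))) (i m : Letter), X ≠ [] → AltChain i X m → AltChain m Y k →
      X.length + Y.length ≤ n → ProperCentred E (X.map M.centred).prod (Y.map M.centred) := by
  induction Y with
  | nil => exact fun _ _ _ _ _ _ _ => trivial
  | cons y Y ih =>
    intro X i m hX hXm hY hlen
    obtain ⟨hy0, m', hy, hY'⟩ := hY
    simp only [List.length_cons] at hlen
    have hpos := List.length_pos_iff.2 hX
    refine ⟨?_, ?_, ?_⟩
    · rw [← hM]
      exact hn i m X hX hXm (by omega)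
    · have := allCentred_of_chain hM hn Y [y] m m' (by simp) ⟨hy0, m', hy, rfl⟩ hY'
        (by simp; omega)
      simpa using this
    · have := ih (X ++ [y]) i m' (by simp) (altChain_append.2 ⟨m, hXm, hy0, m', hy, rfl⟩) hY'
        (by simp; omega)
      simpa using this

/-- If `a` satisfies the moment condition, then so does `u a`, and alternating words have the same
moments for `a` and for `u a`.  Hence all words do. -/
theorem identDistrib_of_isDiag (ha : (E.marked (letterPow a)).IsDiag) :
    IdentDistrib E a (u * a) := by
  obtain ⟨α, hα⟩ := hu.exists_exp_eq
  have heven {i : Letter} {y : List (D × Letter)} (hy : Alt i y i) :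
      (E.marked (letterPow (u * a))).moment y = (E.marked (letterPow a)).moment y := by
    rw [hu.moment_mul hα (k := i.flip) (by simpa using hy)]
    cases i <;> simp [Letter.flip]
  have hodd {i : Letter} {y : List (D × Letter)} (hy : Alt i y i.flip) :
      (E.marked (letterPow (u * a))).moment y = 0 := by
    rw [hu.moment_mul hα hy, ha.odd i y hy, smul_zero]
  rw [identDistrib_iff]
  refine ha.moment_eq_of_alt ⟨fun i y hy => hodd hy, fun i k Y hY hch => ?_⟩
    fun i w hw => (heven hw).symm
  obtain _ | ⟨y, Y⟩ := Y
  · exact absurd rfl hY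
  obtain ⟨R, h1, h2, h3⟩ := exists_gapProd
    (α := fun s => outerScalar α s s) k Y i y hch fun z hz j m hzj => by
      by_cases hmj : m = j
      · subst hmj
        exact hu.centred_mul hzj (heven hzj) fun h => absurd rfl h
      · obtain rfl := Letter.eq_flip_of_ne hmj
        exact hu.centred_mul hzj (by rw [hodd hzj, ha.odd j z hzj]) fun _ => ha.odd j z hzj
  rw [h3, CondExp.marked_exp]
  refine hu.2.2.2.apply_mul_gapProd (hasScalarExp_pre hα i) (hasScalarExp_post hα k) R ?_
    (centred_mem_legAlgebra y) ?_
  · intro r hr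
    obtain ⟨s, hs⟩ := h2 r hr
    refine ⟨by rw [hs]; exact hasScalarExp_gap hα s, ?_⟩
    have : r.2 ∈ Y.map (E.marked (letterPow a)).centred := h1 ▸ List.mem_map_of_mem hr
    obtain ⟨z, -, hz⟩ := List.mem_map.1 this
    exact hz ▸ centred_mem_legAlgebra z
  · rw [h1]
    obtain ⟨hy0, m, hy, hch'⟩ := hch
    have := allCentred_of_chain (E := E) (M := E.marked (letterPow a)) (fun _ => rfl)
      (n := Y.length + 2) (fun i k Y hY hch _ => ha.chain i k Y hY hch) Y [y] i m (by simp)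
      ⟨hy0, m, hy, rfl⟩ hch' (by simp; omega)
    simpa using this

omit hu in
theorem eq_zero_of_eq_smul {V : Type*} [AddCommGroup V] [Module ℂ V] {c : ℂ} (hc : ‖c‖ < 1) {v : V}
    (h : v = c • v) : v = 0 := by
  have h1 : (1 - c) • v = 0 := by rw [sub_smul, one_smul, ← h, sub_self]
  refine (smul_eq_zero.1 h1).resolve_left fun h2 => ?_
  rw [← sub_eq_zero.1 h2] at hc
  simp at hc

/-- If `a` and `u a` have the same distribution, then the expectation of a product of centred
alternating words equals itself times a scalar of modulus less than `1`. -/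
theorem isDiag_of_identDistrib {α : ℂ} (hα : E u = algebraMap ℂ D α) (hα1 : ‖α‖ < 1)
    (hid : IdentDistrib E a (u * a)) : (E.marked (letterPow a)).IsDiag := by
  have hid' := (identDistrib_iff E _ _).1 hid
  have hodd : ∀ (i : Letter) (y : List (D × Letter)), Alt i y i.flip →
      (E.marked (letterPow a)).moment y = 0 := by
    intro i y hy
    have key := hid' y
    rw [hu.moment_mul hα hy] at key
    refine eq_zero_of_eq_smul ?_ key
    cases i
    · exact hα1
    · simpa using hα1
  refine ⟨hodd, fun i k Y => ?_⟩
  induction hn : Y.length using Nat.strong_induction_on generalizing i k Y with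
  | _ n ih =>
  intro hY hch
  obtain _ | ⟨y, Y⟩ := Y
  · exact absurd rfl hY
  obtain rfl | hY0 := eq_or_ne Y []
  · simpa using (E.marked (letterPow a)).exp_centred y
  obtain ⟨R, h1, h2, h3⟩ := exists_gapProd
    (α := fun s => outerScalar α s s) k Y i y hch fun z hz j m hzj =>
      hu.centred_mul hzj (hid' z).symm fun hmj => hodd j z (Letter.eq_flip_of_ne hmj ▸ hzj)
  have hR : ∀ r ∈ R, HasScalarExp E ![{a, star a}, {u, star u}] r.1.1 r.1.2 ∧
      r.2 ∈ legAlgebra D ![{a, star a}, {u, star u}] 0 := by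
    intro r hr
    obtain ⟨s, hs⟩ := h2 r hr
    refine ⟨by rw [hs]; exact hasScalarExp_gap hα s, ?_⟩
    have : r.2 ∈ Y.map (E.marked (letterPow a)).centred := h1 ▸ List.mem_map_of_mem hr
    obtain ⟨z, -, hz⟩ := List.mem_map.1 this
    exact hz ▸ centred_mem_legAlgebra z
  have hproper : ProperCentred E ((E.marked (letterPow a)).centred y) (R.map Prod.snd) := by
    rw [h1]
    obtain ⟨hy0, m, hy, hch'⟩ := hch
    have := properCentred_of_chain (E := E) (M := E.marked (letterPow a)) (fun _ => rfl) (n := n)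
      (fun i k Y hY hch hlen => ih _ hlen i k Y rfl hY hch) Y [y] i m (by simp)
      ⟨hy0, m, hy, rfl⟩ hch' (by rw [← hn]; simp; omega)
    simpa using this
  have hmem : ((y :: Y).map (E.marked (letterPow a)).centred).prod ∈
      legAlgebra D ![{a, star a}, {u, star u}] 0 :=
    Subalgebra.list_prod_mem _ fun x hx => by
      obtain ⟨z, -, rfl⟩ := List.mem_map.1 hx
      exact centred_mem_legAlgebra z
  have key := TwoLetterSpace.exp_prod_centred_congr hid' (y :: Y)
    fun z hz => (hch.alt_of_mem hz).1
  rw [h3, CondExp.marked_exp, CondExp.marked_exp, hu.2.2.2.apply_mul_gapProd_of_proper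
    (hasScalarExp_pre hα i) (hasScalarExp_post hα k) R hR _ (centred_mem_legAlgebra y) hproper, h1,
    ← List.prod_cons, ← List.map_cons, hu.2.2.2.apply_mul_mul (hasScalarExp_pre hα i)
      (hasScalarExp_post hα k) (hu.pre_mul_coe i) (hu.exp_pre_mul_post hα i k) hmem,
    smul_smul] at key
  refine eq_zero_of_eq_smul ?_ key
  -- there is at least one separating unitary, as the chain has at least two words
  have hprod : ‖(R.map fun r => r.1.2).prod‖ < 1 := by
    have hle : ∀ R : List ((A × ℂ) × A), (∀ r ∈ R, ‖r.1.2‖ < 1) →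
        ‖(R.map fun r => r.1.2).prod‖ ≤ 1 := by
      intro R hR
      induction R with
      | nil => simp
      | cons r R ihR =>
        rw [List.map_cons, List.prod_cons, norm_mul]
        exact mul_le_one₀ (hR r (by simp)).le (norm_nonneg _)
          (ihR fun s hs => hR s (List.mem_cons_of_mem _ hs))
    have hlt : ∀ r ∈ R, ‖r.1.2‖ < 1 := by
      intro r hr
      obtain ⟨s, hs⟩ := h2 r hr
      rw [hs]
      cases s
      · exact hα1
      · simpa using hα1
    obtain _ | ⟨r, R⟩ := R
    · exact absurd (by simpa using h1.symm) hY0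
    · rw [List.map_cons, List.prod_cons, norm_mul]
      exact mul_lt_one_of_nonneg_of_lt_one_left (norm_nonneg _) (hlt r (by simp))
        (hle R fun s hs => hlt s (List.mem_cons_of_mem _ hs))
  rw [norm_mul]
  refine mul_lt_one_of_nonneg_of_lt_one_left (norm_nonneg _) hprod ?_
  cases i <;> cases k <;> simp [hα1.le]

end IsFreeScalarUnitary

end Unitary

/-! ### A module over the free product with amalgamation -/

section FreeModule

variable {A : Type u} [Ring A] [StarRing A] [Algebra ℂ A] [StarModule ℂ A]
variable {D : StarSubalgebra ℂ A} (E : CondExp D)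

/-- Right multiplication by `y`, as a left `D`-linear map. -/
def mulRightLin (D : StarSubalgebra ℂ A) (y : A) : A →ₗ[D] A where
  toFun x := x * y
  map_add' x x' := add_mul x x' y
  map_smul' d x := smul_mul_assoc d x y

theorem linearMap_coe {W : Type*} [AddCommGroup W] [Module D W] (f : A →ₗ[D] W) (d : D) :
    f (d : A) = d • f 1 := by
  rw [← map_smul]
  exact congrArg f (mul_one (d : A)).symm

/-- For a left `D`-module `W`, the left `D`-linear maps `A → W` which vanish at `1`. -/
def reducedSubgroup (D : StarSubalgebra ℂ A) (W : Type u) [AddCommGroup W] [Module D W] :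
    AddSubgroup (A →ₗ[D] W) where
  carrier := {f | f 1 = 0}
  add_mem' {f g} hf hg := by
    change f 1 + g 1 = 0
    rw [show f 1 = 0 from hf, show g 1 = 0 from hg, add_zero]
  zero_mem' := rfl
  neg_mem' {f} hf := by
    change -f 1 = 0
    rw [show f 1 = 0 from hf, neg_zero]

/-- The group `reducedSubgroup D W` as a type. -/
def ReducedHom (D : StarSubalgebra ℂ A) (W : Type u) [AddCommGroup W] [Module D W] : Type u :=
  reducedSubgroup D W

instance (W : Type u) [AddCommGroup W] [Module D W] : AddCommGroup (ReducedHom D W) :=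
  inferInstanceAs (AddCommGroup (reducedSubgroup D W))

/-- The left `D`-module structure `(d f)(x) = f(x d)`. -/
instance (W : Type u) [AddCommGroup W] [Module D W] : Module D (ReducedHom D W) where
  smul d f := ⟨f.1.comp (mulRightLin D d), by
    change f.1 (1 * (d : A)) = 0
    rw [one_mul, linearMap_coe, show f.1 1 = 0 from f.2, smul_zero]⟩
  one_smul f := Subtype.ext <| LinearMap.ext fun x => congrArg f.1 (mul_one x)
  mul_smul d e f := Subtype.ext <| LinearMap.ext fun x => congrArg f.1 (mul_assoc x d e).symm
  smul_zero d := rfl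
  smul_add d f g := rfl
  add_smul d e f := Subtype.ext <| LinearMap.ext fun x =>
    (congrArg f.1 (mul_add x d e)).trans (map_add f.1 _ _)
  zero_smul f := Subtype.ext <| LinearMap.ext fun x =>
    (congrArg f.1 (mul_zero x)).trans (map_zero f.1)

/-- The `n`-th homogeneous component of the space of reduced words in `A` and `{1, u}` which do
not begin with an element of `A`.  Tensor products over `D` are replaced with spaces of
`D`-linear maps; the first component consists of the multiples of `Ω` and of `u Ω`. -/
def level (D : StarSubalgebra ℂ A) : ℕ → ModuleCat.{u} D
  | 0 => ModuleCat.of D (D × D)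
  | n + 1 => ModuleCat.of D (ReducedHom D (level D n))

/-- The linear map which an element of a component of positive degree is. -/
def levelHom {n : ℕ} (f : level D (n + 1)) : A →ₗ[D] level D n := f.1

/-- The element of a component of positive degree given by a linear map. -/
def mkLevel {n : ℕ} (f : A →ₗ[D] level D n) (hf : f 1 = 0) : level D (n + 1) := ⟨f, hf⟩

@[simp] theorem levelHom_one {n : ℕ} (f : level D (n + 1)) : levelHom f 1 = 0 := f.2

@[simp] theorem levelHom_mkLevel {n : ℕ} (f : A →ₗ[D] level D n) (hf : f 1 = 0) :
    levelHom (mkLevel f hf) = f := rfl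

theorem levelHom_injective {n : ℕ} {f g : level D (n + 1)} (h : levelHom f = levelHom g) :
    f = g := Subtype.ext h

@[simp] theorem levelHom_add {n : ℕ} (f g : level D (n + 1)) :
    levelHom (f + g) = levelHom f + levelHom g := rfl

@[simp] theorem levelHom_zero {n : ℕ} : levelHom (0 : level D (n + 1)) = 0 := rfl

@[simp] theorem levelHom_smul {n : ℕ} (d : D) (f : level D (n + 1)) (x : A) :
    levelHom (d • f) x = levelHom f (x * (d : A)) := rfl

/-- The two coordinates of an element of the component of degree `0`. -/
def levelPair (w : level D 0) : D × D := w

/-- The element of the component of degree `0` with given coordinates. -/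
def mkPair (w : D × D) : level D 0 := w

/-- The space on which `A` and `u` act: the induced module of `A`, in its coinduced form. -/
abbrev FreeSpace (D : StarSubalgebra ℂ A) : Type u := ∀ n : ℕ, A →ₗ[D] level D n

/-- The action `(a f)(x) = f(x a)` of `A`. -/
def leftAct (D : StarSubalgebra ℂ A) : A →+* AddMonoid.End (FreeSpace D) where
  toFun a :=
    { toFun := fun f n => (f n).comp (mulRightLin D a)
      map_zero' := rfl
      map_add' := fun f g => rfl }
  map_one' := by
    ext f n x
    exact congrArg (f n) (mul_one x)
  map_mul' a b := by
    ext f n x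
    exact congrArg (f n) (mul_assoc x a b).symm
  map_zero' := by
    ext f n x
    exact (congrArg (f n) (mul_zero x)).trans (map_zero (f n))
  map_add' a b := by
    ext f n x
    exact (congrArg (f n) (mul_add x a b)).trans (map_add (f n) _ _)

@[simp] theorem leftAct_apply (a : A) (f : FreeSpace D) (n : ℕ) (x : A) :
    leftAct D a f n x = f n (x * a) := rfl

/-- The map `x ↦ E(x) w`. -/
def expLin {W : Type*} [AddCommGroup W] [Module D W] : W →+ (A →ₗ[D] W) where
  toFun w :=
    { toFun := fun x => E x • w
      map_add' := fun x y => by rw [map_add, add_smul]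
      map_smul' := fun d x => by
        rw [show d • x = (d : A) * x from rfl, E.map_mul_left, mul_smul]; rfl }
  map_zero' := by ext x; exact smul_zero _
  map_add' v w := by ext x; exact smul_add _ _ _

@[simp] theorem expLin_apply {W : Type*} [AddCommGroup W] [Module D W] (w : W) (x : A) :
    expLin E w x = E x • w := rfl

/-- The part of `f` which vanishes at `1`. -/
def reduce {n : ℕ} : (A →ₗ[D] level D n) →+ level D (n + 1) where
  toFun f := mkLevel (f - expLin E (f 1)) (by simp [E.map_one])
  map_zero' := levelHom_injective (by simp)
  map_add' f g := levelHom_injective (by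
    simp only [levelHom_mkLevel, levelHom_add, LinearMap.add_apply, map_add]; abel)

@[simp] theorem levelHom_reduce {n : ℕ} (f : A →ₗ[D] level D n) :
    levelHom (reduce E f) = f - expLin E (f 1) := rfl

/-- The part of `u f` which does not begin with an element of `A`. -/
def flipHead (f : FreeSpace D) : ∀ n : ℕ, level D n
  | 0 => mkPair (levelPair (f 0 1)).swap
  | n + 1 => reduce E (f n)

/-- The action of `u`, an involution: it exchanges `Ω` with `u Ω`, and the words which begin with an
element of `A` with those which begin with `u` followed by such an element. -/
def flipAct : AddMonoid.End (FreeSpace D) where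
  toFun f n := expLin E (flipHead E f n) + levelHom (f (n + 1) 1)
  map_zero' := by
    funext n
    cases n with
    | zero => exact add_zero _ |>.trans (map_zero (expLin E))
    | succ n =>
      change expLin E (reduce E 0) + 0 = 0
      rw [map_zero, map_zero, add_zero]
  map_add' f g := by
    funext n
    have h : flipHead E (f + g) n = flipHead E f n + flipHead E g n := by
      cases n with
      | zero => rfl
      | succ n => exact map_add (reduce E) _ _
    change expLin E (flipHead E (f + g) n) + (levelHom (f (n + 1) 1) + levelHom (g (n + 1) 1)) =
      (expLin E (flipHead E f n) + levelHom (f (n + 1) 1)) +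
        (expLin E (flipHead E g n) + levelHom (g (n + 1) 1))
    rw [h, map_add]; abel

theorem flipAct_apply (f : FreeSpace D) (n : ℕ) :
    flipAct E f n = expLin E (flipHead E f n) + levelHom (f (n + 1) 1) := rfl

theorem flipAct_apply_one (f : FreeSpace D) (n : ℕ) : flipAct E f n 1 = flipHead E f n := by
  simp [flipAct_apply, E.map_one]

theorem flipAct_mul_self : flipAct E * flipAct E = 1 := by
  ext1 f
  funext n
  change flipAct E (flipAct E f) n = f n
  have h : flipHead E (flipAct E f) n = f n 1 := by
    cases n with
    | zero =>
      change mkPair (levelPair (flipAct E f 0 1)).swap = f 0 1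
      rw [flipAct_apply_one]
      exact Prod.swap_swap _
    | succ n =>
      refine levelHom_injective ?_
      change flipAct E f n - expLin E (flipAct E f n 1) = levelHom (f (n + 1) 1)
      rw [flipAct_apply_one, flipAct_apply, add_sub_cancel_left]
  rw [flipAct_apply, h, flipAct_apply_one]
  change expLin E (f n 1) + (f n - expLin E (f n 1)) = f n
  abel

/-- The right action of `D` on the components. -/
def levelRight (d : D) : ∀ n : ℕ, level D n →ₗ[D] level D n
  | 0 =>
    { toFun := fun w => mkPair ((levelPair w).1 * d, (levelPair w).2 * d)
      map_add' := fun v w => Prod.ext (add_mul _ _ _) (add_mul _ _ _)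
      map_smul' := fun e w => Prod.ext (mul_assoc _ _ _) (mul_assoc _ _ _) }
  | n + 1 =>
    { toFun := fun f => mkLevel ((levelRight d n).comp (levelHom f)) (by simp)
      map_add' := fun f g => levelHom_injective (LinearMap.ext fun x =>
        map_add (levelRight d n) _ _)
      map_smul' := fun e f => rfl }

/-- The right action of `D`. -/
def rightAct (d : D) : AddMonoid.End (FreeSpace D) where
  toFun f n := (levelRight d n).comp (f n)
  map_zero' := by funext n; exact LinearMap.comp_zero _
  map_add' f g := by funext n; exact LinearMap.comp_add _ _ _

theorem leftAct_mul_rightAct (a : A) (d : D) :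
    leftAct D a * rightAct d = rightAct d * leftAct D a := rfl

theorem flipAct_mul_rightAct (d : D) : flipAct E * rightAct d = rightAct d * flipAct E := by
  ext1 f
  funext n
  change flipAct E (rightAct d f) n = (levelRight d n).comp (flipAct E f n)
  have h : flipHead E (rightAct d f) n = levelRight d n (flipHead E f n) := by
    cases n with
    | zero => rfl
    | succ n =>
      refine levelHom_injective ?_
      ext x
      change levelRight d n (f n x) - E x • levelRight d n (f n 1) =
        levelRight d n (f n x - E x • f n 1)
      rw [map_sub, map_smul]
  rw [flipAct_apply, h, flipAct_apply]
  ext x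
  change E x • levelRight d n (flipHead E f n) + levelRight d n (levelHom (f (n + 1) 1) x) =
    levelRight d n (E x • flipHead E f n + levelHom (f (n + 1) 1) x)
  rw [map_add, map_smul]

theorem flipAct_mul_leftAct (d : D) :
    flipAct E * leftAct D (d : A) = leftAct D (d : A) * flipAct E := by
  ext1 f
  funext n
  change flipAct E (leftAct D (d : A) f) n = (flipAct E f n).comp (mulRightLin D (d : A))
  have h : flipHead E (leftAct D (d : A) f) n = d • flipHead E f n := by
    cases n with
    | zero =>
      change mkPair (levelPair (f 0 (1 * (d : A)))).swap = _
      rw [one_mul, linearMap_coe]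
      rfl
    | succ n =>
      refine levelHom_injective ?_
      ext x
      change f n (x * (d : A)) - E x • f n (1 * (d : A)) =
        f n (x * (d : A)) - E (x * (d : A)) • f n 1
      rw [one_mul, linearMap_coe, E.map_mul_right, mul_smul]
  rw [flipAct_apply, h, flipAct_apply]
  ext x
  change E x • d • flipHead E f n + levelHom (f (n + 1) (1 * (d : A))) x =
    E (x * (d : A)) • flipHead E f n + levelHom (f (n + 1) 1) (x * (d : A))
  rw [one_mul, linearMap_coe, E.map_mul_right, mul_smul, levelHom_smul]

/-- The components of the vacuum vector. -/
def vacuumLevel (D : StarSubalgebra ℂ A) : ∀ n : ℕ, level D n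
  | 0 => mkPair (1, 0)
  | _ + 1 => 0

/-- The vacuum vector `Ω`. -/
def freeVacuum : FreeSpace D := fun n => expLin E (vacuumLevel D n)

/-- The coefficient of `Ω`. -/
def vacuumCoeff : FreeSpace D →+ D where
  toFun f := (levelPair (f 0 1)).1
  map_zero' := rfl
  map_add' _ _ := rfl

theorem vacuumCoeff_leftAct (d : D) (f : FreeSpace D) :
    vacuumCoeff (leftAct D (d : A) f) = d * vacuumCoeff f := by
  change (levelPair (f 0 (1 * (d : A)))).1 = _
  rw [one_mul, linearMap_coe]
  rfl

theorem vacuumCoeff_rightAct (d : D) (f : FreeSpace D) :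
    vacuumCoeff (rightAct d f) = vacuumCoeff f * d := rfl

theorem leftAct_freeVacuum (d : D) :
    leftAct D (d : A) (freeVacuum E) = rightAct d (freeVacuum E) := by
  funext n
  ext x
  change E (x * (d : A)) • vacuumLevel D n = levelRight d n (E x • vacuumLevel D n)
  rw [E.map_mul_right, mul_smul, map_smul]
  congr 1
  cases n with
  | zero =>
    change mkPair (d * 1, d * 0) = mkPair (1 * d, 0 * d)
    simp
  | succ n => exact (smul_zero _).trans (map_zero _).symm

theorem vacuumCoeff_leftAct_freeVacuum (a : A) :
    vacuumCoeff (leftAct D a (freeVacuum E)) = E a := by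
  change E (1 * a) * 1 = E a
  simp

/-- The sets of vectors between which the operators of the two algebras play ping-pong: sums of
words which begin with an element of `A`, and sums of words which begin with `u`. -/
def BeginsWith (v : FreeSpace D) : Fin 2 → Prop
  | 0 => ∀ n, v n 1 = 0
  | 1 => ∃ w : ∀ n, level D n, (levelPair (w 0)).1 = 0 ∧ ∀ n, v n = expLin E (w n)

/-- The operators of centred elements of `A`, and of centred elements of the algebra of `u` and
`D`. -/
def IsCentredOp (T : AddMonoid.End (FreeSpace D)) : Fin 2 → Prop
  | 0 => ∃ x, E x = 0 ∧ T = leftAct D x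
  | 1 => ∃ d : D, T = leftAct D (d : A) * flipAct E

variable {E}

theorem IsCentredOp.beginsWith {T : AddMonoid.End (FreeSpace D)} {i : Fin 2}
    (hT : IsCentredOp E T i) {v : FreeSpace D}
    (hv : v = freeVacuum E ∨ ∃ j, j ≠ i ∧ BeginsWith E v j) : BeginsWith E (T v) i := by
  fin_cases i
  · obtain ⟨x, hx, rfl⟩ := hT
    obtain ⟨w, hw⟩ : ∃ w : ∀ n, level D n, ∀ n, v n = expLin E (w n) := by
      rcases hv with rfl | ⟨j, hj, hv⟩
      · exact ⟨_, fun _ => rfl⟩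
      · obtain rfl : j = 1 := by
          fin_cases j
          · exact absurd rfl hj
          · rfl
        exact ⟨hv.choose, hv.choose_spec.2⟩
    intro n
    rw [leftAct_apply, hw, one_mul, expLin_apply, hx, zero_smul]
  · obtain ⟨d, rfl⟩ := hT
    obtain ⟨h0, h1⟩ : (levelPair (v 0 1)).2 = 0 ∧ ∀ n, v (n + 1) 1 = 0 := by
      rcases hv with rfl | ⟨j, hj, hv⟩
      · refine ⟨?_, fun n => smul_zero _⟩
        change E 1 * 0 = 0
        simp
      · obtain rfl : j = 0 := by
          fin_cases j
          · rfl
          · exact absurd rfl hj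
        exact ⟨by rw [hv 0]; rfl, fun n => hv (n + 1)⟩
    refine ⟨fun n => d • flipHead E v n, ?_, fun n => ?_⟩
    · change d * (levelPair (v 0 1)).2 = 0
      rw [h0, mul_zero]
    · ext x
      change (flipAct E v n) (x * (d : A)) = E x • d • flipHead E v n
      rw [flipAct_apply, h1, levelHom_zero, add_zero, expLin_apply, E.map_mul_right, mul_smul]

/-- Ping-pong: alternating products of centred operators have no vacuum expectation. -/
theorem vacuumCoeff_prod_eq_zero (L : List (Fin 2 × AddMonoid.End (FreeSpace D))) (hL : L ≠ [])
    (hch : L.IsChain fun p q => p.1 ≠ q.1) (hmem : ∀ p ∈ L, IsCentredOp E p.2 p.1) :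
    vacuumCoeff ((L.map Prod.snd).prod (freeVacuum E)) = 0 := by
  have key : ∀ (L : List (Fin 2 × AddMonoid.End (FreeSpace D)))
      (p : Fin 2 × AddMonoid.End (FreeSpace D)), (p :: L).IsChain (fun p q => p.1 ≠ q.1) →
      (∀ q ∈ p :: L, IsCentredOp E q.2 q.1) →
      BeginsWith E (((p :: L).map Prod.snd).prod (freeVacuum E)) p.1 := by
    intro L
    induction L with
    | nil =>
      intro p _ hmem
      rw [List.map_singleton, List.prod_singleton]
      exact (hmem p (by simp)).beginsWith (.inl rfl)
    | cons q L ih =>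
      intro p hch hmem
      rw [List.isChain_cons_cons] at hch
      have := ih q hch.2 fun r hr => hmem r (List.mem_cons_of_mem _ hr)
      rw [List.map_cons, List.prod_cons]
      exact (hmem p (by simp)).beginsWith (.inr ⟨q.1, hch.1.symm, this⟩)
  obtain _ | ⟨p, L⟩ := L
  · exact absurd rfl hL
  have h := key L p hch hmem
  generalize ((p :: L).map Prod.snd).prod (freeVacuum E) = v at h
  obtain ⟨i, T⟩ := p
  fin_cases i
  · change (levelPair (v 0 1)).1 = 0
    rw [h 0]; rfl
  · obtain ⟨w, hw0, hw⟩ := h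
    change (levelPair (v 0 1)).1 = 0
    rw [hw 0, expLin_apply]
    change E 1 * (levelPair (w 0)).1 = 0
    rw [hw0, mul_zero]

end FreeModule

/-! ### Symmetrization of an algebra -/

/-- For a complex algebra `R`, the algebra `R × R̄ᵒᵖ`, where the second factor carries the conjugate
scalar multiplication, with the involution `(S, T)⋆ = (T, S)`.  It replaces an algebra of operators
which carries no involution. -/
def StarDouble (R : Type u) : Type u := R × Rᵐᵒᵖ

namespace StarDouble

variable {R : Type u} [Ring R]

instance : Ring (StarDouble R) := inferInstanceAs (Ring (R × Rᵐᵒᵖ))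

/-- The first component, as a ring homomorphism. -/
def fstHom : StarDouble R →+* R := RingHom.fst R Rᵐᵒᵖ

/-- The second component, as a ring homomorphism. -/
def sndHom : StarDouble R →+* Rᵐᵒᵖ := RingHom.snd R Rᵐᵒᵖ

/-- The element with given components. -/
def mk (S T : R) : StarDouble R := (S, .op T)

@[simp] theorem fstHom_mk (S T : R) : fstHom (mk S T) = S := rfl

@[simp] theorem unop_sndHom_mk (S T : R) : (sndHom (mk S T)).unop = T := rfl

theorem ext {x y : StarDouble R} (h₁ : fstHom x = fstHom y)
    (h₂ : (sndHom x).unop = (sndHom y).unop) : x = y :=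
  Prod.ext h₁ (MulOpposite.unop_injective h₂)

instance : StarRing (StarDouble R) where
  star x := mk (sndHom x).unop (fstHom x)
  star_involutive _ := rfl
  star_mul _ _ := rfl
  star_add _ _ := rfl

@[simp] theorem fstHom_star (x : StarDouble R) : fstHom (star x) = (sndHom x).unop := rfl

@[simp] theorem sndHom_star (x : StarDouble R) : (sndHom (star x)).unop = fstHom x := rfl

variable [Algebra ℂ R]

instance : Algebra ℂ (StarDouble R) :=
  RingHom.toAlgebra'
    ((algebraMap ℂ R).prod ((algebraMap ℂ Rᵐᵒᵖ).comp (starRingEnd ℂ)) : ℂ →+* R × Rᵐᵒᵖ)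
    fun c x => Prod.ext (Algebra.commutes c x.1) (Algebra.commutes (starRingEnd ℂ c) x.2)

theorem algebraMap_eq (c : ℂ) :
    algebraMap ℂ (StarDouble R) c = mk (algebraMap ℂ R c) (algebraMap ℂ R (star c)) := rfl

instance : StarModule ℂ (StarDouble R) where
  star_smul c x := by
    have h : star (algebraMap ℂ (StarDouble R) c) = algebraMap ℂ (StarDouble R) (star c) := by
      rw [algebraMap_eq, algebraMap_eq]
      exact ext (by simp) (by simp)
    rw [Algebra.smul_def, Algebra.smul_def, star_mul, h, Algebra.commutes]

/-- A linear functional `φ` on `R` with values in a `⋆`-algebra induces the functional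
`(S, T) ↦ (φ(S) + φ(T)⋆) / 2` on `R × R̄ᵒᵖ`, which commutes with the involution. -/
def exp {V : Type u} [Ring V] [StarRing V] [Algebra ℂ V] [StarModule ℂ V] (φ : R →+ V)
    (hφ : ∀ (c : ℂ) (S : R), φ (c • S) = c • φ S) : StarDouble R →ₗ[ℂ] V where
  toFun x := (1 / 2 : ℂ) • (φ (fstHom x) + star (φ (sndHom x).unop))
  map_add' x y := by
    rw [← smul_add, map_add, map_add, map_add, MulOpposite.unop_add, map_add, star_add]
    congr 1
    abel
  map_smul' c x := by
    have h1 : fstHom (c • x) = c • fstHom x := by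
      rw [Algebra.smul_def, map_mul, algebraMap_eq, fstHom_mk, Algebra.smul_def]
    have h2 : (sndHom (c • x)).unop = star c • (sndHom x).unop := by
      rw [Algebra.smul_def, map_mul, MulOpposite.unop_mul, algebraMap_eq, unop_sndHom_mk,
        ← Algebra.commutes, Algebra.smul_def]
    rw [h1, h2, hφ, hφ, star_smul, star_star, ← smul_add, smul_comm, RingHom.id_apply]

end StarDouble

/-! ### The enlargement -/

section Enlargement

variable {A : Type u} [Ring A] [StarRing A] [Algebra ℂ A] [StarModule ℂ A]
variable {D : StarSubalgebra ℂ A} (E : CondExp D)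

/-- The ring of operators which commute with the right action of `D` and with the scalars. -/
def opSubring (D : StarSubalgebra ℂ A) : Subring (AddMonoid.End (FreeSpace D)) :=
  Subring.centralizer
    (Set.range (rightAct (D := D)) ∪ Set.range fun c : ℂ => leftAct D (algebraMap ℂ A c))

/-- The ring `opSubring D` as a type. -/
def OpRing (D : StarSubalgebra ℂ A) : Type u := opSubring D

instance : Ring (OpRing D) := inferInstanceAs (Ring (opSubring D))

variable (D) in
/-- The inclusion of the ring of operators. -/
def OpRing.val : OpRing D →+* AddMonoid.End (FreeSpace D) := (opSubring D).subtype

theorem mem_opSubring {T : AddMonoid.End (FreeSpace D)} :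
    T ∈ opSubring D ↔ (∀ d : D, T * rightAct d = rightAct d * T) ∧
      ∀ c : ℂ, T * leftAct D (algebraMap ℂ A c) = leftAct D (algebraMap ℂ A c) * T := by
  rw [opSubring, Subring.mem_centralizer_iff]
  constructor
  · exact fun h => ⟨fun d => (h _ (.inl ⟨d, rfl⟩)).symm, fun c => (h _ (.inr ⟨c, rfl⟩)).symm⟩
  · rintro ⟨h1, h2⟩ _ (⟨d, rfl⟩ | ⟨c, rfl⟩)
    · exact (h1 d).symm
    · exact (h2 c).symm

/-- The representation of `A`. -/
def leftOp (D : StarSubalgebra ℂ A) : A →+* OpRing D :=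
  (leftAct D).codRestrict (opSubring D) fun a => mem_opSubring.2
    ⟨leftAct_mul_rightAct a, fun c => by rw [← map_mul, ← map_mul, Algebra.commutes]⟩

/-- The operator of `u`. -/
def flipOp : OpRing D :=
  ⟨flipAct E, mem_opSubring.2 ⟨flipAct_mul_rightAct E, fun c =>
    flipAct_mul_leftAct E (algebraMap ℂ D c)⟩⟩

instance : Algebra ℂ (OpRing D) :=
  RingHom.toAlgebra' ((leftOp D).comp (algebraMap ℂ A)) fun c T =>
    Subtype.ext ((mem_opSubring.1 T.2).2 c).symm

theorem flipOp_mul_self : flipOp E * flipOp E = 1 := Subtype.ext (flipAct_mul_self E)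

theorem flipOp_mul_leftOp (d : D) :
    flipOp E * leftOp D (d : A) = leftOp D (d : A) * flipOp E :=
  Subtype.ext (flipAct_mul_leftAct E d)

/-- The vacuum expectation of an operator. -/
def opExp : OpRing D →+ D where
  toFun T := vacuumCoeff (OpRing.val D T (freeVacuum E))
  map_zero' := rfl
  map_add' _ _ := map_add vacuumCoeff _ _

theorem opExp_leftOp (a : A) : opExp E (leftOp D a) = E a := vacuumCoeff_leftAct_freeVacuum E a

theorem opExp_leftOp_mul (d : D) (T : OpRing D) :
    opExp E (leftOp D (d : A) * T) = d * opExp E T := vacuumCoeff_leftAct d _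

theorem opExp_mul_leftOp (d : D) (T : OpRing D) :
    opExp E (T * leftOp D (d : A)) = opExp E T * d := by
  change vacuumCoeff (T.1 (leftAct D (d : A) (freeVacuum E))) = _
  rw [leftAct_freeVacuum]
  exact (congrArg (fun S : AddMonoid.End (FreeSpace D) => vacuumCoeff (S (freeVacuum E)))
    ((mem_opSubring.1 T.2).1 d)).trans (vacuumCoeff_rightAct d _)

theorem opExp_leftOp_mul_flipOp (d : D) : opExp E (leftOp D (d : A) * flipOp E) = 0 := by
  rw [opExp_leftOp_mul]
  convert mul_zero d
  exact vacuumCoeff_prod_eq_zero (E := E) [(1, flipAct E)] (by simp) (by simp)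
    (by simpa using ⟨(1 : D), by simp⟩)

variable (D) in
/-- The enlarged algebra.  The factor `A` makes the inclusion of `A` injective. -/
abbrev Enlarged : Type u := A × StarDouble (OpRing D)

variable (D) in
/-- The inclusion of `A`. -/
def enlargedIncl : A →⋆ₐ[ℂ] Enlarged D where
  toFun a := (a, .mk (leftOp D a) (leftOp D (star a)))
  map_one' := Prod.ext rfl (StarDouble.ext (by simp) (by simp))
  map_mul' a b := Prod.ext rfl (StarDouble.ext (by simp) (by simp))
  map_zero' := Prod.ext rfl (StarDouble.ext (by simp) (by simp))
  map_add' a b := Prod.ext rfl (StarDouble.ext (by simp) (by simp))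
  commutes' c := Prod.ext rfl (StarDouble.ext rfl (by
    change leftOp D (star (algebraMap ℂ A c)) = leftOp D (algebraMap ℂ A (star c))
    rw [algebraMap_star_comm]))
  map_star' a := Prod.ext rfl (StarDouble.ext rfl (by
    change leftOp D (star (star a)) = leftOp D a
    rw [star_star]))

theorem enlargedIncl_snd (a : A) :
    (enlargedIncl D a).2 = .mk (leftOp D a) (leftOp D (star a)) := rfl

theorem enlargedIncl_injective : Function.Injective (enlargedIncl D) := fun _ _ h =>
  congrArg Prod.fst h

theorem opExp_smul (c : ℂ) (T : OpRing D) : opExp E (c • T) = c • opExp E T := by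
  rw [Algebra.smul_def, Algebra.smul_def]
  exact opExp_leftOp_mul E (algebraMap ℂ D c) T

/-- The vacuum expectation on the enlarged algebra. -/
def enlargedFun : Enlarged D →ₗ[ℂ] D :=
  (StarDouble.exp (opExp E) (opExp_smul E)).comp (LinearMap.snd ℂ A _)

theorem enlargedFun_apply (b : Enlarged D) :
    enlargedFun E b = (1 / 2 : ℂ) • (opExp E (StarDouble.fstHom b.2) +
      star (opExp E (StarDouble.sndHom b.2).unop)) := rfl

theorem half_smul_add_self (d : D) : (1 / 2 : ℂ) • (d + d) = d := by
  rw [← two_smul ℂ d, smul_smul]; norm_num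

theorem enlargedFun_incl (a : A) : enlargedFun E (enlargedIncl D a) = E a := by
  rw [enlargedFun_apply, enlargedIncl_snd, StarDouble.fstHom_mk, StarDouble.unop_sndHom_mk,
    opExp_leftOp, opExp_leftOp, E.map_star, star_star, half_smul_add_self]

theorem enlargedFun_bimod (d e : D) (b : Enlarged D) :
    enlargedFun E (enlargedIncl D d * b * enlargedIncl D e) = d * enlargedFun E b * e := by
  have h1 : StarDouble.fstHom (enlargedIncl D (d : A) * b * enlargedIncl D (e : A)).2 =
      leftOp D (d : A) * StarDouble.fstHom b.2 * leftOp D (e : A) := by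
    simp [enlargedIncl_snd]
  have h2 : (StarDouble.sndHom (enlargedIncl D (d : A) * b * enlargedIncl D (e : A)).2).unop =
      leftOp D ((star e : D) : A) * ((StarDouble.sndHom b.2).unop *
        leftOp D ((star d : D) : A)) := by
    simp [enlargedIncl_snd]
  rw [enlargedFun_apply, enlargedFun_apply, h1, h2, opExp_mul_leftOp, opExp_leftOp_mul,
    opExp_leftOp_mul, opExp_mul_leftOp, star_mul, star_mul, star_star, star_star,
    mul_smul_comm, smul_mul_assoc, mul_add, add_mul]

/-- The conditional expectation on the enlarged algebra. -/
def enlargedExp : CondExp (D.map (enlargedIncl D)) where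
  toFun b := ⟨enlargedIncl D (enlargedFun E b : D), ⟨_, (enlargedFun E b).2, rfl⟩⟩
  map_add' b c := Subtype.ext (by simp)
  map_smul' c b := Subtype.ext (by simp)
  map_one' := Subtype.ext (by
    have h := enlargedFun_incl E 1
    rw [map_one, E.map_one] at h
    simp [h])
  map_bimod' := by
    rintro ⟨_, d, hd, rfl⟩ ⟨_, e, he, rfl⟩ b
    refine Subtype.ext ?_
    change enlargedIncl D (enlargedFun E (enlargedIncl D d * b * enlargedIncl D e) : D) =
      enlargedIncl D d * enlargedIncl D (enlargedFun E b : D) * enlargedIncl D e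
    rw [← map_mul, ← map_mul]
    exact congrArg (fun z : D => enlargedIncl D (z : A)) (enlargedFun_bimod E ⟨d, hd⟩ ⟨e, he⟩ b)
  map_star' b := Subtype.ext (by
    change enlargedIncl D (enlargedFun E (star b) : D) =
      star (enlargedIncl D (enlargedFun E b : D))
    rw [← map_star]
    change enlargedIncl D (enlargedFun E (star b) : D) =
      enlargedIncl D ((star (enlargedFun E b) : D) : A)
    refine congrArg (fun z : D => enlargedIncl D (z : A)) ?_
    rw [enlargedFun_apply, enlargedFun_apply, Prod.snd_star, StarDouble.fstHom_star,
      StarDouble.sndHom_star, star_smul, star_add, star_star, add_comm]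
    congr 1
    simp)

theorem coe_enlargedExp (b : Enlarged D) :
    (enlargedExp E b : Enlarged D) = enlargedIncl D (enlargedFun E b : D) := rfl

theorem isEnlargement_enlargedExp : IsEnlargement E (enlargedIncl D) (enlargedExp E) :=
  ⟨enlargedIncl_injective, fun x => by rw [coe_enlargedExp, enlargedFun_incl]⟩

/-- A scalar unitary of order `2` which is free from `A` over `D`. -/
def enlargedUnitary : Enlarged D := (1, .mk (flipOp E) (flipOp E))

theorem star_enlargedUnitary : star (enlargedUnitary E) = enlargedUnitary E :=
  Prod.ext (star_one A) rfl

theorem enlargedUnitary_mul_self : enlargedUnitary E * enlargedUnitary E = 1 :=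
  Prod.ext (one_mul 1) (StarDouble.ext (flipOp_mul_self E) (flipOp_mul_self E))

theorem enlargedUnitary_mul_incl (d : D) :
    enlargedUnitary E * enlargedIncl D (d : A) = enlargedIncl D (d : A) * enlargedUnitary E := by
  refine Prod.ext ((one_mul _).trans (mul_one _).symm)
    (StarDouble.ext (flipOp_mul_leftOp E d) ?_)
  exact (flipOp_mul_leftOp E (star d)).symm

theorem enlargedFun_incl_mul_unitary (d : D) :
    enlargedFun E (enlargedIncl D (d : A) * enlargedUnitary E) = 0 := by
  have h2 : (StarDouble.sndHom (enlargedIncl D (d : A) * enlargedUnitary E).2).unop =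
      leftOp D ((star d : D) : A) * flipOp E := flipOp_mul_leftOp E (star d)
  rw [enlargedFun_apply, h2, opExp_leftOp_mul_flipOp]
  change (1 / 2 : ℂ) • (opExp E (leftOp D (d : A) * flipOp E) + star 0) = 0
  rw [opExp_leftOp_mul_flipOp]
  simp

theorem enlargedExp_unitary : enlargedExp E (enlargedUnitary E) = 0 := by
  refine Subtype.ext ?_
  have := enlargedFun_incl_mul_unitary E 1
  rw [OneMemClass.coe_one, map_one, one_mul] at this
  rw [coe_enlargedExp, this]
  simp

/-- Both components of a product of alternating centred elements are products of alternating
centred operators. -/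
theorem enlargedFun_prod_eq_zero (L : List (Fin 2 × Enlarged D)) (hL : L ≠ [])
    (hch : L.IsChain fun p q => p.1 ≠ q.1)
    (hmem : ∀ p ∈ L, IsCentredOp E (OpRing.val D (StarDouble.fstHom p.2.2)) p.1 ∧
      IsCentredOp E (OpRing.val D (StarDouble.sndHom p.2.2).unop) p.1) :
    enlargedFun E (L.map Prod.snd).prod = 0 := by
  let f : Enlarged D →+* AddMonoid.End (FreeSpace D) :=
    (OpRing.val D).comp (StarDouble.fstHom.comp (RingHom.snd A _))
  let g : Enlarged D →+* (OpRing D)ᵐᵒᵖ := StarDouble.sndHom.comp (RingHom.snd A _)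
  have h1 : opExp E (StarDouble.fstHom (L.map Prod.snd).prod.2) = 0 := by
    have := vacuumCoeff_prod_eq_zero (E := E) (L.map fun p => (p.1, f p.2)) (by simpa using hL)
      (by rw [List.isChain_map]; exact hch)
      (by
        intro q hq
        obtain ⟨p, hp, rfl⟩ := List.mem_map.1 hq
        exact (hmem p hp).1)
    have e : f (L.map Prod.snd).prod =
        ((L.map fun p => (p.1, f p.2)).map Prod.snd).prod := by
      rw [map_list_prod, List.map_map, List.map_map]; rfl
    rw [← e] at this
    exact this
  have h2 : opExp E (StarDouble.sndHom (L.map Prod.snd).prod.2).unop = 0 := by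
    have := vacuumCoeff_prod_eq_zero (E := E)
      (L.reverse.map fun p => (p.1, OpRing.val D (g p.2).unop))
      (by simpa using hL)
      (by
        rw [List.isChain_map, List.isChain_reverse]
        exact hch.imp fun _ _ h => h.symm)
      (by
        intro q hq
        obtain ⟨p, hp, rfl⟩ := List.mem_map.1 hq
        exact (hmem p (List.mem_reverse.1 hp)).2)
    have e : OpRing.val D (g (L.map Prod.snd).prod).unop =
        ((L.reverse.map fun p => (p.1, OpRing.val D (g p.2).unop)).map
          Prod.snd).prod := by
      rw [map_list_prod, MulOpposite.unop_list_prod, map_list_prod]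
      simp only [List.map_reverse, List.map_map]
      rfl
    rw [← e] at this
    exact this
  rw [enlargedFun_apply, h1, h2]
  simp

/-- Centred elements of the algebra of `a` and `D` act as centred elements of `A`, and those of the
algebra of `u` and `D` have the form `d u`, so freeness is the ping-pong argument in each of the two
components. -/
theorem freeOver_enlarged (a : A) : FreeOver (enlargedExp E)
    ![{enlargedIncl D a, star (enlargedIncl D a)},
      {enlargedUnitary E, star (enlargedUnitary E)}] := by
  have hzero {b : Enlarged D} (hb : enlargedExp E b = 0) : enlargedFun E b = 0 := by
    have h : (enlargedExp E b : Enlarged D) = 0 := by rw [hb]; rfl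
    rw [coe_enlargedExp, ← map_zero (enlargedIncl D)] at h
    exact Subtype.ext (enlargedIncl_injective h)
  have hcomm := enlargedUnitary_mul_incl E
  have hsq := enlargedUnitary_mul_self E
  have hcentred : ∀ (i : Fin 2) (b : Enlarged D),
      b ∈ Algebra.adjoin ℂ ((![{enlargedIncl D a, star (enlargedIncl D a)},
        {enlargedUnitary E, star (enlargedUnitary E)}] : Fin 2 → Set (Enlarged D)) i ∪
          (D.map (enlargedIncl D) : Set (Enlarged D))) → enlargedExp E b = 0 →
      IsCentredOp E (OpRing.val D (StarDouble.fstHom b.2)) i ∧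
        IsCentredOp E (OpRing.val D (StarDouble.sndHom b.2).unop) i := by
    intro i b hb h0
    replace h0 := hzero h0
    fin_cases i
    · -- an element of the algebra generated by `a` and `D` belongs to `A`
      have hb' : b ∈ (enlargedIncl D : A →ₐ[ℂ] Enlarged D).range := by
        refine (Algebra.adjoin_le ?_) hb
        rintro _ ((rfl | rfl) | ⟨d, -, rfl⟩)
        · exact ⟨a, rfl⟩
        · exact ⟨star a, map_star (enlargedIncl D) a⟩
        · exact ⟨d, rfl⟩
      obtain ⟨x, rfl⟩ := hb'
      have hx : E x = 0 := (enlargedFun_incl E x).symm.trans h0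
      exact ⟨⟨x, hx, rfl⟩, ⟨star x, by rw [E.map_star, hx, star_zero], rfl⟩⟩
    · -- an element of the algebra generated by `u` and `D` has the form `d + d' u`
      obtain ⟨d, d', rfl⟩ : ∃ d d' : D, b = enlargedIncl D (d : A) +
          enlargedIncl D (d' : A) * enlargedUnitary E := by
        clear h0
        induction hb using Algebra.adjoin_induction with
        | mem x hx =>
          rcases hx with (rfl | rfl) | ⟨d, hd, rfl⟩
          · exact ⟨0, 1, by simp⟩
          · exact ⟨0, 1, by simp [star_enlargedUnitary]⟩
          · exact ⟨⟨d, hd⟩, 0, by simp⟩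
        | algebraMap c =>
          refine ⟨algebraMap ℂ D c, 0, ?_⟩
          have : enlargedIncl D ((algebraMap ℂ D c : D) : A) = algebraMap ℂ _ c :=
            AlgHomClass.commutes (enlargedIncl D) c
          rw [ZeroMemClass.coe_zero, map_zero, zero_mul, add_zero]
          exact this.symm
        | add x y _ _ hx hy =>
          obtain ⟨d, d', rfl⟩ := hx
          obtain ⟨e, e', rfl⟩ := hy
          refine ⟨d + e, d' + e', ?_⟩
          simp only [AddMemClass.coe_add, map_add, add_mul]
          abel
        | mul x y _ _ hx hy =>
          obtain ⟨d, d', rfl⟩ := hx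
          obtain ⟨e, e', rfl⟩ := hy
          refine ⟨d * e + d' * e', d * e' + d' * e, ?_⟩
          simp only [AddMemClass.coe_add, MulMemClass.coe_mul, map_add, map_mul, add_mul, mul_add]
          have h1 : enlargedIncl D (d' : A) * enlargedUnitary E * enlargedIncl D (e : A) =
              enlargedIncl D (d' : A) * enlargedIncl D (e : A) * enlargedUnitary E := by
            rw [mul_assoc, hcomm, mul_assoc]
          have h2 : enlargedIncl D (d' : A) * enlargedUnitary E *
              (enlargedIncl D (e' : A) * enlargedUnitary E) =
              enlargedIncl D (d' : A) * enlargedIncl D (e' : A) := by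
            rw [mul_assoc, ← mul_assoc (enlargedUnitary E), hcomm, mul_assoc, hsq, mul_one]
          rw [h1, h2]
          simp only [mul_assoc]
          abel
      rw [map_add, enlargedFun_incl, enlargedFun_incl_mul_unitary, add_zero, E.map_coe] at h0
      subst h0
      have e : enlargedIncl D ((0 : D) : A) + enlargedIncl D (d' : A) * enlargedUnitary E =
          enlargedIncl D (d' : A) * enlargedUnitary E := by simp
      rw [e]
      refine ⟨⟨d', rfl⟩, ⟨star d', ?_⟩⟩
      exact flipAct_mul_leftAct E (star d')
  intro n hn s x hs hmem h0
  refine Subtype.ext ?_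
  have hL := enlargedFun_prod_eq_zero E (List.ofFn fun k => (s k, x k))
    (by rw [Ne, List.ofFn_eq_nil_iff]; omega)
    (by
      rw [List.isChain_iff_getElem]
      intro k hk
      simpa using hs ⟨k, by simp at hk; omega⟩ ⟨k + 1, by simpa using hk⟩ rfl)
    (by
      intro p hp
      obtain ⟨k, rfl⟩ := List.mem_ofFn.1 hp
      exact hcentred _ _ (hmem k) (h0 k))
  rw [List.map_ofFn] at hL
  rw [coe_enlargedExp]
  change enlargedIncl D (enlargedFun E (List.ofFn (Prod.snd ∘ fun k => (s k, x k))).prod : D) = 0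
  rw [hL]
  simp

theorem isFreeScalarUnitary_enlarged (a : A) :
    IsFreeScalarUnitary (enlargedExp E) (enlargedIncl D a) (enlargedUnitary E) := by
  have hcomm (d : D.map (enlargedIncl D)) :
      enlargedUnitary E * (d : Enlarged D) = d * enlargedUnitary E := by
    obtain ⟨_, d, hd, rfl⟩ := d
    exact enlargedUnitary_mul_incl E ⟨d, hd⟩
  refine ⟨⟨?_, fun d => ⟨hcomm d, ?_⟩, fun k l => ?_⟩, ?_, ?_, freeOver_enlarged E a⟩
  · rw [star_enlargedUnitary]
  · rw [star_enlargedUnitary, hcomm]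
  · rw [star_enlargedUnitary, ← pow_add]
    rcases Nat.even_or_odd' (k + l) with ⟨m, hm | hm⟩
    · refine ⟨1, ?_⟩
      rw [hm, pow_mul, pow_two, enlargedUnitary_mul_self, one_pow, CondExp.map_one, map_one]
    · refine ⟨0, ?_⟩
      rw [hm, pow_succ, pow_mul, pow_two, enlargedUnitary_mul_self, one_pow, one_mul, map_zero,
        enlargedExp_unitary]
  · rw [star_enlargedUnitary, enlargedUnitary_mul_self]
  · rw [star_enlargedUnitary, enlargedUnitary_mul_self]

end Enlargement

/-! ### Passing to an enlargement -/

section Transport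

variable {A : Type u} [Ring A] [StarRing A] [Algebra ℂ A] [StarModule ℂ A]
  {B : Type u} [Ring B] [StarRing B] [Algebra ℂ B] [StarModule ℂ B]
  {D : StarSubalgebra ℂ A} {E : CondExp D} {ι : A →⋆ₐ[ℂ] B} {F : CondExp (D.map ι)}

theorem IsEnlargement.apply_eq_zero_iff (h : IsEnlargement E ι F) {x : A} :
    F (ι x) = 0 ↔ E x = 0 := by
  rw [← ZeroMemClass.coe_eq_zero, h.2, ← map_zero ι, h.1.eq_iff, ZeroMemClass.coe_eq_zero]

/-- The spaces `P₁₁, P₁₂, P₂₁, P₂₂` do not change in an enlargement. -/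
theorem IsEnlargement.map_P (h : IsEnlargement E ι F) (a : A) (i j : Fin 2) :
    P F (ι a) i j = (P E a i j).map ι.toAlgHom.toLinearMap := by
  have hD : Subalgebra.toSubmodule (D.map ι).toSubalgebra =
      (Subalgebra.toSubmodule D.toSubalgebra).map ι.toAlgHom.toLinearMap := rfl
  have hspan (x : A) : Submodule.span ℂ {ι x} =
      (Submodule.span ℂ {x}).map ι.toAlgHom.toLinearMap := by
    rw [Submodule.map_span, Set.image_singleton]; rfl
  have hker (S : Submodule ℂ A) :
      S.map ι.toAlgHom.toLinearMap ⊓ LinearMap.ker F.toLinearMap =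
        (S ⊓ LinearMap.ker E.toLinearMap).map ι.toAlgHom.toLinearMap := by
    ext y
    constructor
    · rintro ⟨⟨x, hx, rfl⟩, hy⟩
      exact ⟨x, ⟨hx, h.apply_eq_zero_iff.1 hy⟩, rfl⟩
    · rintro ⟨x, ⟨hx, h0⟩, rfl⟩
      exact ⟨⟨x, hx, rfl⟩, h.apply_eq_zero_iff.2 h0⟩
  unfold P
  simp only [← map_star ι, hspan, hD, ← Submodule.map_mul, ← Submodule.map_pow,
    ← Submodule.map_iSup, hker]
  fin_cases i <;> fin_cases j <;> rfl

theorem IsEnlargement.momentCondition_iff (h : IsEnlargement E ι F) (a : A) :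
    MomentCondition F (ι a) ↔ MomentCondition E a := by
  constructor
  · intro H n hn i x hx
    rw [← h.apply_eq_zero_iff, map_list_prod, List.map_ofFn]
    refine H n hn i _ fun k => ?_
    rw [h.map_P]
    exact ⟨x k, hx k, rfl⟩
  · intro H n hn i y hy
    simp only [h.map_P] at hy
    choose x hx hxy using hy
    obtain rfl : y = ι ∘ x := funext fun k => (hxy k).symm
    rw [← List.map_ofFn, ← map_list_prod, h.apply_eq_zero_iff]
    exact H n hn i x hx

end Transport

end OpValued

end

theorem mainTheorem5 {A : Type u} [Ring A] [StarRing A] [Algebra ℂ A] [StarModule ℂ A]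
    (D : StarSubalgebra ℂ A) (E : OpValued.CondExp D) (a : A) :
    List.TFAE
      [OpValued.IsRDiagonal E a,
        OpValued.MomentCondition E a,
        OpValued.CumulantCondition E a,
        OpValued.ExistsUnitaryCondition E a,
        OpValued.ForallUnitaryCondition E a] := by
  have h12 : OpValued.MomentCondition E a ↔ OpValued.CumulantCondition E a :=
    (OpValued.momentCondition_iff_isDiag E a).trans
      (OpValued.cumulantCondition_iff_isDiag E a).symm
  have h14 : OpValued.MomentCondition E a → OpValued.ForallUnitaryCondition E a := by
    intro h B _ _ _ _ ι F u hF hu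
    exact hu.identDistrib_of_isDiag
      ((OpValued.momentCondition_iff_isDiag F (ι a)).1 ((hF.momentCondition_iff a).2 h))
  have h43 : OpValued.ForallUnitaryCondition E a → OpValued.ExistsUnitaryCondition E a := by
    intro h
    have hE := OpValued.isEnlargement_enlargedExp E
    have hu := OpValued.isFreeScalarUnitary_enlarged E a
    refine ⟨OpValued.Enlarged D, inferInstance, inferInstance, inferInstance, inferInstance,
      OpValued.enlargedIncl D, OpValued.enlargedExp E, OpValued.enlargedUnitary E, hE, hu,
      ⟨0, ?_, by simp⟩, h _ _ _ _ hE hu⟩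
    rw [OpValued.enlargedExp_unitary, map_zero]
  have h31 : OpValued.ExistsUnitaryCondition E a → OpValued.MomentCondition E a := by
    rintro ⟨B, _, _, _, _, ι, F, u, hF, hu, ⟨α, hα, hα1⟩, hid⟩
    exact (hF.momentCondition_iff a).1
      ((OpValued.momentCondition_iff_isDiag F (ι a)).2 (hu.isDiag_of_identDistrib hα hα1 hid))
  have h01 : OpValued.IsRDiagonal E a ↔ OpValued.MomentCondition E a := by
    unfold OpValued.IsRDiagonal
    tauto
  tfae_have 1 ↔ 2 := h01
  tfae_have 2 ↔ 3 := h12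
  tfae_have 2 → 5 := h14
  tfae_have 5 → 4 := h43
  tfae_have 4 → 2 := h31
  tfae_finish
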